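/- **Setting.** Let $k\ge 1$ and $r\ge 2$ be integers. For each (large) $n$ consider a stochastic block model with $n$ nodes and $k$ communities of sizes $n_i=n_i(n)\ge 1$, $\sum_i n_i=n$, with edge probabilities $q_{ij}=q_{ij}(n)=q_{ji}\in[0,1)$, $p_i:=q_{ii}$, and with $a_i=a_i(n)\in\{0,\dots,n_i\}$ seeds in community $i$. Put $g_i=(1-\frac1r)\big(\frac{(r-1)!}{n_i p_i^r}\big)^{1/(r-1)}$. Assume that, as $n\to\infty$, for all $i,j$: $n_i/n_j\to\nu_{ij}\in(0,\infty)$; $1/n_i\ll p_i\ll n_i^{-1/r}$; $q_{ij}\le\min\{p_i,p_j\}$ (for all large $n$); $q_{ij}/p_i\to\gamma_{ij}\in[0,1]$; $p_i/p_j\to\mu_{ij}\in(0,\infty)$; $a_i/g_i\to\alpha_i\ge 0$; that $\alpha_1\ge\dots\ge\alpha_k$ and $\alpha_1>0$; and that the matrix $\chi_{ij}=\gamma_{ij}(\nu_{ij}\mu_{ij}^r)^{1/(r-1)}$ is irreducible. For $x\in\mathbb R^k$ let $\rho_i(x)=\alpha_i-x_i+r^{-1}(1-r^{-1})^{r-1}\big(\sum_j\chi_{ij}x_j\big)^r$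 and $\rho=(\rho_1,\dots,\rho_k)$; let $J_\rho$ be the Jacobian matrix of $\rho$. Inequalities between vectors are componentwise. Let $$\mathcal D=\Big\{x\in[0,\tfrac r{r-1}]^k:\ x_i+\sum_{j\ne i}\chi_{ij}x_j\le\tfrac r{r-1}\ \ \forall i\Big\},$$ let $\tilde{\mathcal D}$ be the set of $x\in\mathcal D$ for which equality holds in the last inequality for some $i$, let $\mathcal D_\rho=\{x\in\mathcal D:\rho_1(x)=\dots=\rho_k(x)\}$ and $\mathcal Z=\{x\in\mathcal D:\rho(x)=0\}$. Let $\phi_{PF}(x)$ be the positive eigenvector of $J_\rho(x)$ (unique up to scaling when $J_\rho(x)$ is irreducible, which is the case at every point at which it is used) and $\lambda_{PF}(x)$ its eigenvalue. *Initial point.* Let $\chi=\min\{\chi_{ij}:\chi_{ij}>0\}$, $\beta_0=\alpha_1/2$, $\beta_h=\frac12 r^{-1}(1-r^{-1})^{r-1}(\chi\beta_{h-1})^r$ for $h\geq 1$; let $\mathcal K_h$ be the set of communities at distance $h$ from community $1$ in the graph on $\{1,\dots,k\}$ with edges $\{i,j\}$, $\chi_{ij}>0$; let $\bar d$ be the largest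 $h$ with $\mathcal K_h\ne\emptyset$; let $x_0^{(-1)}=0$, $x_0^{(h)}=\sum_{s=0}^h\beta_s\mathbf 1_{\mathcal K_s}$ and $x_0=x_0^{(\bar d)}$. Let $\mathcal S$ be the union of the segments $[x_0^{(h-1)},x_0^{(h)}]$, $0\le h\le\bar d$. *Cauchy problem.* Let $y_0\in\mathbb R$ and let $x(y)$, $y\in[y_0,y_+)$, be the maximal solution of $x'=\rho(x)$, $x(y_0)=x_0$, within the closed ball with centre $x_0$ and radius $\mathrm{diam}\,\mathcal D$. Let $\mathcal E$ be the closure of the connected component of $\{x\in\mathcal D:\rho(x)\ge 0\}$ that contains $x_0$ (empty if $x_0\notin\mathcal D$), $y_{\mathcal E}=\inf\{y\in(y_0,y_+):x(y)\notin\overset\circ{\mathcal E}\}$ with $\inf\emptyset=+\infty$, $x(y_{\mathcal E})=\lim_{y_0<y\uparrow y_{\mathcal E}}x(y)$, $\mathcal C_{\mathcal E}=\{x(y):y_0\le y\le y_{\mathcal E}\}$ and $\tilde{\mathcal S}=\{x\in\mathcal D: x=x(y_{\mathcal E})+\theta\phi_{PF}(x(y_{\mathcal E})),\ \theta\ge 0\}$.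 Call a set $\mathcal C\subset\mathbb R^k$ *good* if it is the trace of a continuous componentwise non-decreasing curve and $\mathcal C\subset\mathcal D$, $0\in\mathcal C$, $\mathcal C\cap\tilde{\mathcal D}\ne\emptyset$. *Conditions* (with $\min\emptyset=+\infty$): - $(\mathcal Sub)$: $\min_{\mathcal D_\rho}\rho_1<0$; $(\mathcal Crit)$: $\min_{\mathcal D_\rho}\rho_1=0$; $(\mathcal Sup)$: $\min_{\mathcal D_\rho}\rho_1>0$. - $(\mathbf{Sub})$: there is $x\in\mathcal D$ with $\rho(x)<0$. $(\mathbf{Crit})$: $\mathcal Z=\{z\}$ with $z\in\overset\circ{\mathcal D}$, $\det J_\rho(z)=0$ and $\lambda_{PF}(z)=0$. $(\mathbf{Sup})$: $\rho(x)\ne0$ for all $x\in\mathcal D$. - $(\mathbf{Sub})'$: $y_{\mathcal E}=+\infty$, $x(y_{\mathcal E})\in\mathcal Z\cap\overset\circ{\mathcal D}$, $\mathcal S\cup\mathcal C_{\mathcal E}\cup\tilde{\mathcal S}$ is good, and $\min_{x\in\mathcal C_{\mathcal E}\cup\tilde{\mathcal S}}\min_i\rho_i(x)<0$. $(\mathbf{Crit})'$: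 the same with $\min_{x\in\mathcal C_{\mathcal E}\cup\tilde{\mathcal S}}\min_i\rho_i(x)=0$. $(\mathbf{Sup})'$: $y_{\mathcal E}<+\infty$, $x(y_{\mathcal E})\in\tilde{\mathcal D}$, $\rho(x(y_{\mathcal E}))>0$, $\mathcal S\cup\mathcal C_{\mathcal E}$ is good, and $\min_{x\in\mathcal C_{\mathcal E}}\min_i\rho_i(x)>0$. **Theorem.** The maximal solution of the Cauchy problem exists, and: (i) $(\mathcal Sub)$, $(\mathbf{Sub})$ and $(\mathbf{Sub})'$ are equivalent. (ii) $(\mathcal Sup)$ and $(\mathbf{Sup})$ are equivalent and are implied by $(\mathbf{Sup})'$; if $x_0\in\overset\circ{\mathcal D}$, then all three are equivalent. (iii) If $k\ge2$, then $(\mathcal Crit)$, $(\mathbf{Crit})$ and $(\mathbf{Crit})'$ are equivalent. -/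

import Mathlib

open Filter Topology Asymptotics

noncomputable section

namespace Bootstrap

/-- Points of `ℝᵏ` (Euclidean norm). -/
abbrev Vec (k : ℕ) := EuclideanSpace ℝ (Fin k)

/-! ### The sequence of stochastic block models -/

/-- The deterministic parameters of a sequence of stochastic block models with `k` communities,
indexed by the number `n` of nodes. -/
structure SBMSequence (k : ℕ) where
  /-- `size n i` is the number of nodes of the `i`-th community. -/
  size : ℕ → Fin k → ℕ
  /-- `q n i j` is the probability of an edge between a node of community `i` and a node of
  community `j`; the probability inside community `i` is `q n i i`. -/
  q : ℕ → Fin k → Fin k → ℝ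
  /-- `seeds n i` is the number of seeds in community `i`. -/
  seeds : ℕ → Fin k → ℕ

/-- The edge probability `p_n^{(i)} = q_n^{(ii)}` inside community `i`. -/
def SBMSequence.p {k : ℕ} (M : SBMSequence k) (n : ℕ) (i : Fin k) : ℝ := M.q n i i

/-- `g_n^{(i)} = (1 - 1/r) ((r-1)! / (n_i p_i^r))^{1/(r-1)}`, the critical number of seeds. -/
def SBMSequence.g {k : ℕ} (M : SBMSequence k) (r n : ℕ) (i : Fin k) : ℝ :=
  (1 - 1 / (r : ℝ)) *
    (((r - 1).factorial : ℝ) / ((M.size n i : ℝ) * M.p n i ^ r)) ^ (1 / ((r : ℝ) - 1))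

/-- `χ_ij = γ_ij (ν_ij μ_ij^r)^{1/(r-1)}`, the value of
`lim q_n^{(ij)} g_n^{(j)} / (p_n^{(i)} g_n^{(i)})`. -/
def chiMatrix {k : ℕ} (r : ℕ) (nu gam mu : Fin k → Fin k → ℝ) : Matrix (Fin k) (Fin k) ℝ :=
  Matrix.of fun i j => gam i j * (nu i j * mu i j ^ r) ^ (1 / ((r : ℝ) - 1))

/-- The model assumptions. `r` is the threshold of bootstrap percolation; `nu`, `gam`, `mu` and
`alpha` are the limits `lim n_i / n_j`, `lim q_ij / p_i`, `lim p_i / p_j` and `lim a_i / g_i`. -/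
structure ModelAssumptions {k : ℕ} [NeZero k] (r : ℕ) (M : SBMSequence k)
    (nu gam mu : Fin k → Fin k → ℝ) (alpha : Fin k → ℝ) : Prop where
  two_le_r : 2 ≤ r
  size_pos : ∀ᶠ n in atTop, ∀ i, 1 ≤ M.size n i
  size_sum : ∀ᶠ n in atTop, ∑ i, M.size n i = n
  q_mem : ∀ᶠ n in atTop, ∀ i j, 0 ≤ M.q n i j ∧ M.q n i j < 1
  q_symm : ∀ᶠ n in atTop, ∀ i j, M.q n i j = M.q n j i
  seeds_le : ∀ᶠ n in atTop, ∀ i, M.seeds n i ≤ M.size n i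
  nu_pos : ∀ i j, 0 < nu i j
  tendsto_nu : ∀ i j, Tendsto (fun n => (M.size n i : ℝ) / M.size n j) atTop (𝓝 (nu i j))
  p_lower : ∀ i, (fun n => 1 / (M.size n i : ℝ)) =o[atTop] (fun n => M.p n i)
  p_upper : ∀ i, (fun n => M.p n i) =o[atTop] (fun n => 1 / (M.size n i : ℝ) ^ (1 / (r : ℝ)))
  q_le : ∀ᶠ n in atTop, ∀ i j, M.q n i j ≤ min (M.p n i) (M.p n j)
  gam_mem : ∀ i j, gam i j ∈ Set.Icc (0 : ℝ) 1
  tendsto_gam : ∀ i j, Tendsto (fun n => M.q n i j / M.p n i) atTop (𝓝 (gam i j))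
  mu_pos : ∀ i j, 0 < mu i j
  tendsto_mu : ∀ i j, Tendsto (fun n => M.p n i / M.p n j) atTop (𝓝 (mu i j))
  alpha_nonneg : ∀ i, 0 ≤ alpha i
  tendsto_alpha : ∀ i, Tendsto (fun n => (M.seeds n i : ℝ) / M.g r n i) atTop (𝓝 (alpha i))
  irreducible : (chiMatrix r nu gam mu).IsIrreducible
  alpha_antitone : Antitone alpha
  alpha_zero_pos : 0 < alpha 0

/-! ### The limiting vector field and the conditions on `𝓓` -/

/-- The parameters of the limiting vector field `ρ`; the communities are numbered from `0`. -/
structure LimitData (k : ℕ) where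
  r : ℕ
  chi : Matrix (Fin k) (Fin k) ℝ
  alpha : Fin k → ℝ

namespace LimitData

variable {k : ℕ} (P : LimitData k)

/-- The constant `r⁻¹ (1 - r⁻¹)^{r-1}`. -/
def c : ℝ := (P.r : ℝ)⁻¹ * (1 - (P.r : ℝ)⁻¹) ^ (P.r - 1)

/-- `ρ_i(x) = α_i - x_i + r⁻¹ (1 - r⁻¹)^{r-1} (∑_j x_j χ_ij)^r`. -/
def rho (x : Vec k) : Vec k :=
  WithLp.toLp 2 fun i => P.alpha i - x i + P.c * (∑ j, x j * P.chi i j) ^ P.r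

/-- `r / (r - 1)`. -/
def top : ℝ := (P.r : ℝ) / ((P.r : ℝ) - 1)

/-- `x_i + ∑_{j ≠ i} χ_ij x_j`. -/
def rowSum (x : Vec k) (i : Fin k) : ℝ := x i + ∑ j ∈ Finset.univ.erase i, P.chi i j * x j

/-- The set `𝓓`. -/
def D : Set (Vec k) := {x | (∀ i, 0 ≤ x i ∧ x i ≤ P.top) ∧ ∀ i, P.rowSum x i ≤ P.top}

/-- The set `𝓓̃` of the points of `𝓓` at which some row sum equals `r / (r - 1)`. -/
def Dtilde : Set (Vec k) := {x | x ∈ P.D ∧ ∃ i, P.rowSum x i = P.top}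

/-- The set `𝓓_ρ` of the points of `𝓓` at which all `ρ_i` agree. -/
def Drho : Set (Vec k) := {x | x ∈ P.D ∧ ∀ i j, P.rho x i = P.rho x j}

/-- The set `𝒵` of the zeros of `ρ` in `𝓓`. -/
def zeros : Set (Vec k) := {x | x ∈ P.D ∧ ∀ i, P.rho x i = 0}

/-- The Jacobian matrix `(∂ρ_i / ∂x_j)`. -/
def jacobian (x : Vec k) : Matrix (Fin k) (Fin k) ℝ :=
  Matrix.of fun i j => fderiv ℝ (fun y => P.rho y i) x (EuclideanSpace.single j 1)

/-- `phi` is a (componentwise) positive eigenvector of `A` and `lam` is its eigenvalue. For a matrix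
with nonnegative off-diagonal entries that is irreducible, the Perron-Frobenius theorem
gives exactly one such `lam`, and `phi` is unique up to a positive factor. -/
def IsPerronFrobenius (A : Matrix (Fin k) (Fin k) ℝ) (lam : ℝ) (phi : Vec k) : Prop :=
  (∀ i, 0 < phi i) ∧ ∀ i, (A.mulVec phi) i = lam * phi i

/-- `min_{𝓓_ρ} ρ_1 < 0`. -/
def MinSub [NeZero k] : Prop := ∃ m < 0, IsLeast ((fun x => P.rho x 0) '' P.Drho) m

/-- `min_{𝓓_ρ} ρ_1 = 0`. -/
def MinCrit [NeZero k] : Prop := IsLeast ((fun x => P.rho x 0) '' P.Drho) 0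

/-- `min_{𝓓_ρ} ρ_1 > 0`, where the minimum over the empty set is `+∞`. -/
def MinSup [NeZero k] : Prop :=
  P.Drho = ∅ ∨ ∃ m > 0, IsLeast ((fun x => P.rho x 0) '' P.Drho) m

/-- `ρ(x) < 0` (componentwise) for some `x` in `𝓓`. -/
def Sub : Prop := ∃ x ∈ P.D, ∀ i, P.rho x i < 0

/-- `𝒵 = {z}` with `z` in the interior of `𝓓`, `det J_ρ(z) = 0` and `λ_PF(z) = 0`. -/
def Crit : Prop :=
  ∃ z, P.zeros = {z} ∧ z ∈ interior P.D ∧ (P.jacobian z).det = 0 ∧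
    ∃ phi, IsPerronFrobenius (P.jacobian z) 0 phi

/-- `ρ` has no zero in `𝓓`. -/
def Sup : Prop := ∀ x ∈ P.D, P.rho x ≠ 0

/-! ### The initial point -/

/-- `χ`, the least positive entry of the matrix. -/
def chiMin : ℝ := sInf {t | 0 < t ∧ ∃ i j, P.chi i j = t}

/-- `β_0 = α_1 / 2`, `β_h = (r⁻¹ (1 - r⁻¹)^{r-1} / 2) (χ β_{h-1})^r`. -/
def beta [NeZero k] : ℕ → ℝ
  | 0 => P.alpha 0 / 2
  | h + 1 => P.c / 2 * (P.chiMin * beta h) ^ P.r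

/-- `𝒦_h`, the communities at distance `h` from the first one. -/
def shell [NeZero k] : ℕ → Set (Fin k)
  | 0 => {0}
  | h + 1 => {i | i ≠ 0 ∧ 0 < (P.chi ^ (h + 1)) 0 i ∧
      ∀ s, 1 ≤ s → s ≤ h → (P.chi ^ s) 0 i = 0}

/-- `d̄`, the largest distance from the first community. -/
def dbar [NeZero k] : ℕ := sSup {h | (P.shell h).Nonempty}

/-- `∑_{s < m} β_s 1_{𝒦_s}`, which is `x_0^{(m-1)}`; for `m = 0` it is `x_0^{(-1)} = 0`. -/
def start [NeZero k] (m : ℕ) : Vec k :=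
  WithLp.toLp 2 fun i => ∑ s ∈ Finset.range m, (P.shell s).indicator (fun _ => P.beta s) i

/-- The initial point `x_0 = x_0^{(d̄)}`. -/
def x0 [NeZero k] : Vec k := P.start (P.dbar + 1)

/-- The polygonal line `𝒮` through `0 = x_0^{(-1)}, x_0^{(0)}, …, x_0^{(d̄)} = x_0`. -/
def S [NeZero k] : Set (Vec k) :=
  ⋃ h ∈ Set.Iic P.dbar, segment ℝ (P.start h) (P.start (h + 1))

/-! ### The Cauchy problem -/

/-- `x` solves `x' = ρ(x)`, `x(y₀) = x_0` on `[y₀, T)` and stays in the closed ball with centre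
`x_0` and radius `diam 𝓓`. -/
def IsSolutionOn [NeZero k] (y₀ : ℝ) (T : EReal) (x : ℝ → Vec k) : Prop :=
  x y₀ = P.x0 ∧ ∀ y : ℝ, y₀ ≤ y → (y : EReal) < T →
    x y ∈ Metric.closedBall P.x0 (Metric.diam P.D) ∧
      HasDerivWithinAt x (P.rho (x y)) (Set.Ici y₀) y

/-- `x` is the maximal solution; its interval of existence is `[y₀, yplus)`. -/
def IsMaximalSolution [NeZero k] (y₀ : ℝ) (yplus : EReal) (x : ℝ → Vec k) : Prop :=
  (y₀ : EReal) < yplus ∧ P.IsSolutionOn y₀ yplus x ∧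
    ∀ (T : EReal) (x' : ℝ → Vec k), P.IsSolutionOn y₀ T x' → T ≤ yplus

/-- `𝓔' = {x ∈ 𝓓 : ρ(x) ≥ 0}`. -/
def Eprime : Set (Vec k) := {x | x ∈ P.D ∧ ∀ i, 0 ≤ P.rho x i}

/-- `𝓔`, the closure of the connected component of `𝓔'` that contains `x_0`. -/
def E [NeZero k] : Set (Vec k) := closure (connectedComponentIn P.Eprime P.x0)

/-- `y_𝓔`, the first exit time from the interior of `𝓔`; it is `+∞` if there is no exit. -/
def exitTime [NeZero k] (y₀ : ℝ) (yplus : EReal) (x : ℝ → Vec k) : EReal :=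
  sInf ((fun y : ℝ => (y : EReal)) ''
    {y : ℝ | y₀ < y ∧ (y : EReal) < yplus ∧ x y ∉ interior P.E})

/-- `p = x(y_𝓔) = lim x(y)` as `y₀ < y ↑ y_𝓔`, where `yE = y_𝓔` may be `+∞`. -/
def IsExitPoint (y₀ : ℝ) (yE : EReal) (x : ℝ → Vec k) (p : Vec k) : Prop :=
  Tendsto x (comap (fun y : ℝ => (y : EReal)) (𝓝[Set.Ioo (y₀ : EReal) yE] yE)) (𝓝 p)

/-- `𝒞_𝓔`, the trace of `x` on `[y₀, y_𝓔]`, where `p = x(y_𝓔)`. -/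
def curveE (y₀ : ℝ) (yE : EReal) (x : ℝ → Vec k) (p : Vec k) : Set (Vec k) :=
  x '' {y : ℝ | y₀ ≤ y ∧ (y : EReal) < yE} ∪ {p}

/-- `𝒮̃ = {p + θ φ : θ ≥ 0} ∩ 𝓓`. -/
def Stilde (p phi : Vec k) : Set (Vec k) := {x | x ∈ P.D ∧ ∃ θ : ℝ, 0 ≤ θ ∧ x = p + θ • phi}

/-- `C` is the trace of a continuous componentwise non-decreasing curve. -/
def IsMonotoneTrace (C : Set (Vec k)) : Prop :=
  ∃ ζ : ℝ → Vec k, ContinuousOn ζ (Set.Icc 0 1) ∧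
    (∀ i, MonotoneOn (fun t => ζ t i) (Set.Icc 0 1)) ∧ ζ '' Set.Icc 0 1 = C

/-- `C` is the trace of a continuous non-decreasing curve, `C ⊆ 𝓓`, `0 ∈ C` and `C` meets `𝓓̃`. -/
def IsGoodCurve (C : Set (Vec k)) : Prop :=
  IsMonotoneTrace C ∧ C ⊆ P.D ∧ 0 ∈ C ∧ (C ∩ P.Dtilde).Nonempty

/-- All values `ρ_i(x)` with `x ∈ A`; its least element is `min_{x ∈ A} min_i ρ_i(x)`. -/
def valuesOn (A : Set (Vec k)) : Set ℝ := {t | ∃ x ∈ A, ∃ i, P.rho x i = t}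

/-- The conditions that the sub-critical and the critical case have in common, and
`min_{𝒞_𝓔 ∪ 𝒮̃} min_i ρ_i = m`. -/
def InteriorExit [NeZero k] (y₀ : ℝ) (yplus : EReal) (x : ℝ → Vec k) (m : ℝ) : Prop :=
  P.exitTime y₀ yplus x = ⊤ ∧
    ∃ p, IsExitPoint y₀ (P.exitTime y₀ yplus x) x p ∧ p ∈ P.zeros ∩ interior P.D ∧
      ∃ lam phi, IsPerronFrobenius (P.jacobian p) lam phi ∧
        P.IsGoodCurve
          (P.S ∪ curveE y₀ (P.exitTime y₀ yplus x) x p ∪ P.Stilde p phi) ∧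
        IsLeast (P.valuesOn (curveE y₀ (P.exitTime y₀ yplus x) x p ∪ P.Stilde p phi)) m

/-- The sub-critical condition in terms of the Cauchy problem. -/
def SubPrime [NeZero k] (y₀ : ℝ) (yplus : EReal) (x : ℝ → Vec k) : Prop :=
  ∃ m < 0, P.InteriorExit y₀ yplus x m

/-- The critical condition in terms of the Cauchy problem. -/
def CritPrime [NeZero k] (y₀ : ℝ) (yplus : EReal) (x : ℝ → Vec k) : Prop :=
  P.InteriorExit y₀ yplus x 0

/-- The super-critical condition in terms of the Cauchy problem. -/
def SupPrime [NeZero k] (y₀ : ℝ) (yplus : EReal) (x : ℝ → Vec k) : Prop :=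
  P.exitTime y₀ yplus x < ⊤ ∧
    ∃ p, IsExitPoint y₀ (P.exitTime y₀ yplus x) x p ∧ p ∈ P.Dtilde ∧ (∀ i, 0 < P.rho p i) ∧
      P.IsGoodCurve (P.S ∪ curveE y₀ (P.exitTime y₀ yplus x) x p) ∧
      ∃ m > 0, IsLeast (P.valuesOn (curveE y₀ (P.exitTime y₀ yplus x) x p)) m

end LimitData

end Bootstrap

end

/-! On the nonnegative orthant `ρ_i(x) + x_i` is a nondecreasing convex function of `x`: a constant
plus a multiple of the `r`-th power of the row sum `lin x i`. So `ρ` is convex (`drho_le`) and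
quasi-monotone (`rho_le_of_le`), and irreducibility spreads strict inequalities to all components.
All conditions reduce to two questions: does `ρ` have a zero in `𝓓`, and is `ρ < 0` somewhere in
`𝓓`?

Equilibria. Below a point with `ρ ≤ -m` a minimal such point satisfies `ρ = -m` in every component
(`exists_rho_eq`). Hence `ρ < 0` somewhere forces a zero, and the minimum over `𝓓_ρ` has the sign
predicted by the two questions. In the remaining case, a zero but no point with `ρ < 0`, strict
convexity makes the zero unique (`zeros_subsingleton`). For `k ≥ 2` the zero is interior, and its
Perron-Frobenius eigenvalue vanishes, since otherwise a move along the eigenvector, up or down,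
would make `ρ` negative. Conversely, at a zero with eigenvalue `0` the tangent inequality excludes
`ρ < 0`.

Cauchy problem. Since `ρ(x_0) > 0` and the Jacobian has nonnegative off-diagonal entries, `ρ` stays
positive along the solution, which therefore increases (`rho_pos`). Every `w ≥ 0` with `ρ(w) ≤ 0` is
a barrier above it (`solution_lt`). If there is a zero, the solution is trapped in the interior of
`𝓓`, exists forever and converges to a zero `p`. On the ray from `p` along the positive eigenvector,
`ρ` takes negative values if `ρ < 0` somewhere in `𝓓`, because then the eigenvalue is negative;
otherwise, with `p` interior, the eigenvalue is `0` and `ρ ≥ 0` on the ray. If there is no zero, the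
solution cannot stay in the interior of `𝓓`; started there, it leaves through `𝓓̃`, because its
coordinates are positive. -/

namespace Bootstrap

/-! ### Positive eigenvectors of irreducible nonnegative matrices. -/

section PerronFrobenius

variable {k : ℕ}

/-- A set of indices that contains some `i`, and with `i` all `j` such that `A j i > 0`, contains
all indices. -/
def Connects (A : Matrix (Fin k) (Fin k) ℝ) : Prop :=
  ∀ N : Set (Fin k), N.Nonempty → (∀ i ∈ N, ∀ j, 0 < A j i → j ∈ N) → N = Set.univ

theorem connects_of_isIrreducible {A : Matrix (Fin k) (Fin k) ℝ} (hA : A.IsIrreducible) :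
    Connects A := by
  rintro N ⟨i, hi⟩ hN
  have key : ∀ m : ℕ, ∀ j, 0 < (A ^ m) j i → j ∈ N := by
    intro m
    induction m with
    | zero =>
      intro j hj
      by_cases h : j = i
      · exact h ▸ hi
      · simp [h] at hj
    | succ m ih =>
      intro j hj
      rw [pow_succ', Matrix.mul_apply] at hj
      obtain ⟨l, -, hl⟩ := Finset.exists_lt_of_sum_lt
        (f := fun _ : Fin k => (0 : ℝ)) (by simpa using hj)
      have h1 : 0 ≤ A j l := hA.nonneg j l
      have h3 : 0 < A j l := by
        rcases h1.eq_or_lt with h | h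
        · rw [← h] at hl; simp at hl
        · exact h
      exact hN l (ih l (pos_of_mul_pos_right hl h1)) j h3
  refine Set.eq_univ_of_forall fun j => ?_
  obtain ⟨m, -, hm⟩ := (Matrix.isIrreducible_iff_exists_pow_pos hA.nonneg).1 hA j i
  exact key m j hm

/-- The union of the `N n` is closed under the edges, hence everything, and finitely many indices
are reached at a common finite stage. This spreads a strict inequality from one component to all
along an iteration. -/
theorem Connects.exists_eq_univ {A : Matrix (Fin k) (Fin k) ℝ} (hA : Connects A)
    (N : ℕ → Set (Fin k)) (hmono : ∀ n, N n ⊆ N (n + 1))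
    (hstep : ∀ n, ∀ i ∈ N n, ∀ j, 0 < A j i → j ∈ N (n + 1)) (h0 : (N 0).Nonempty) :
    ∃ n, N n = Set.univ := by
  have hU : (⋃ n, N n) = Set.univ := by
    apply hA
    · obtain ⟨i, hi⟩ := h0
      exact ⟨i, Set.mem_iUnion.2 ⟨0, hi⟩⟩
    · intro i hi j hj
      obtain ⟨n, hn⟩ := Set.mem_iUnion.1 hi
      exact Set.mem_iUnion.2 ⟨n + 1, hstep n i hn j hj⟩
  have hex : ∀ i, ∃ n, i ∈ N n := fun i => Set.mem_iUnion.1 (hU ▸ Set.mem_univ i)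
  choose n hn using hex
  refine ⟨Finset.univ.sup n, Set.eq_univ_of_forall fun i => ?_⟩
  exact monotone_nat_of_le_succ hmono (Finset.le_sup (Finset.mem_univ i)) (hn i)

theorem mulVec_nonneg_of_nonneg {A : Matrix (Fin k) (Fin k) ℝ} (hA : ∀ i j, 0 ≤ A i j)
    {v : Fin k → ℝ} (hv : ∀ i, 0 ≤ v i) (i : Fin k) : 0 ≤ A.mulVec v i := by
  rw [Matrix.mulVec, dotProduct]
  exact Finset.sum_nonneg fun j _ => mul_nonneg (hA i j) (hv j)

theorem mulVec_pos_of_pos {A : Matrix (Fin k) (Fin k) ℝ} (hA : ∀ i j, 0 ≤ A i j)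
    {v : Fin k → ℝ} (hv : ∀ i, 0 ≤ v i) {i j : Fin k} (hij : 0 < A i j) (hj : 0 < v j) :
    0 < A.mulVec v i := by
  rw [Matrix.mulVec, dotProduct]
  exact Finset.sum_pos' (fun l _ => mul_nonneg (hA i l) (hv l)) ⟨j, Finset.mem_univ j, mul_pos hij hj⟩

/-- A nonnegative matrix that connects all indices maps a vector with `λ x ≤ A x`, `λ x ≠ A x`
under iteration of `1 + A` to one at which the inequality is strict everywhere. -/
theorem Connects.exists_mulVec_gt {A : Matrix (Fin k) (Fin k) ℝ} (hA : Connects A)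
    (h0 : ∀ i j, 0 ≤ A i j) {lam : ℝ} {x : Fin k → ℝ} (hx : ∀ i, 0 ≤ x i)
    (hle : ∀ i, lam * x i ≤ A.mulVec x i) (hne : ∃ i, lam * x i < A.mulVec x i) :
    ∃ u : Fin k → ℝ, (∀ i, x i ≤ u i) ∧ ∀ i, lam * u i < A.mulVec u i := by
  let u : ℕ → Fin k → ℝ := fun n => (fun v => v + A.mulVec v)^[n] x
  have hu : ∀ n, u (n + 1) = u n + A.mulVec (u n) := fun n =>
    Function.iterate_succ_apply' _ _ _
  -- The defect `A u - λ u` evolves under the same operator `1 + A` as `u`, since `A` commutes with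
  -- it; so its support grows along the edges.
  let w : ℕ → Fin k → ℝ := fun n => A.mulVec (u n) - lam • u n
  have hw : ∀ n, w (n + 1) = w n + A.mulVec (w n) := by
    intro n
    simp only [w, hu, Matrix.mulVec_add, Matrix.mulVec_sub, Matrix.mulVec_smul, smul_add]
    abel
  have hux : ∀ n, ∀ i, x i ≤ u n i := by
    intro n
    induction n with
    | zero => exact fun i => le_rfl
    | succ n ih =>
      intro i
      have := mulVec_nonneg_of_nonneg h0 (fun i => (hx i).trans (ih i)) i
      rw [hu, Pi.add_apply]
      linarith [ih i]
  have hw0 : ∀ n, ∀ i, 0 ≤ w n i := by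
    intro n
    induction n with
    | zero => exact fun i => sub_nonneg.2 (hle i)
    | succ n ih =>
      intro i
      have := mulVec_nonneg_of_nonneg h0 ih i
      rw [hw, Pi.add_apply]
      linarith [ih i]
  obtain ⟨n, hn⟩ := hA.exists_eq_univ (fun n => {i | 0 < w n i})
    (fun n i hi => by
      have := mulVec_nonneg_of_nonneg h0 (hw0 n) i
      simp only [Set.mem_ofPred_eq, hw, Pi.add_apply] at hi ⊢
      linarith)
    (fun n i hi j hj => by
      have := mulVec_pos_of_pos h0 (hw0 n) hj hi
      simp only [Set.mem_ofPred_eq, hw, Pi.add_apply]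
      linarith [hw0 n j])
    (by
      obtain ⟨i, hi⟩ := hne
      exact ⟨i, sub_pos.2 hi⟩)
  refine ⟨u n, hux n, fun i => ?_⟩
  have : i ∈ {i | 0 < w n i} := hn ▸ Set.mem_univ i
  exact sub_pos.1 this

/-- **Perron-Frobenius**: existence of a positive eigenvector. -/
theorem Connects.exists_pos_eigenvector [NeZero k] {A : Matrix (Fin k) (Fin k) ℝ}
    (hA : Connects A) (h0 : ∀ i j, 0 ≤ A i j) :
    ∃ (lam : ℝ) (v : Fin k → ℝ), (∀ i, 0 < v i) ∧ ∀ i, A.mulVec v i = lam * v i := by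
  let C : ℝ := ∑ i, ∑ j, A i j
  -- Collatz-Wielandt: the eigenvalue is the largest `λ` with `λ x ≤ A x` for some `x` in the
  -- simplex. The bound `C` makes the set of pairs compact.
  let K : Set (ℝ × (Fin k → ℝ)) := {p | p ∈ Set.Icc 0 C ×ˢ stdSimplex ℝ (Fin k) ∧
    ∀ i, p.1 * p.2 i ≤ A.mulVec p.2 i}
  have hK : IsCompact K := by
    have hcl : IsClosed {p : ℝ × (Fin k → ℝ) | ∀ i, p.1 * p.2 i ≤ A.mulVec p.2 i} := by
      rw [Set.ofPred_forall]
      refine isClosed_iInter fun i => isClosed_le (by fun_prop) ?_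
      exact (continuous_apply i).comp (Continuous.matrix_mulVec continuous_const continuous_snd)
    exact (isCompact_Icc.prod (isCompact_stdSimplex ℝ (Fin k))).inter_right hcl
  have hbound : ∀ (l : ℝ) (x : Fin k → ℝ), x ∈ stdSimplex ℝ (Fin k) →
      (∀ i, l * x i ≤ A.mulVec x i) → l ≤ C := by
    intro l x hx hl
    calc l = ∑ i, l * x i := by rw [← Finset.mul_sum, hx.2, mul_one]
      _ ≤ ∑ i, A.mulVec x i := Finset.sum_le_sum fun i _ => hl i
      _ ≤ C := by
        refine Finset.sum_le_sum fun i _ => ?_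
        rw [Matrix.mulVec, dotProduct]
        refine Finset.sum_le_sum fun j _ => ?_
        have h1 : x j ≤ 1 := hx.2 ▸ Finset.single_le_sum (fun i _ => hx.1 i) (Finset.mem_univ j)
        exact mul_le_of_le_one_right (h0 i j) h1
  have hne : K.Nonempty := by
    have hs : (Pi.single 0 1 : Fin k → ℝ) ∈ stdSimplex ℝ (Fin k) := single_mem_stdSimplex ℝ 0
    have hC : 0 ≤ C := Finset.sum_nonneg fun i _ => Finset.sum_nonneg fun j _ => h0 i j
    refine ⟨(0, Pi.single 0 1), ⟨⟨le_rfl, hC⟩, hs⟩, fun i => ?_⟩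
    rw [zero_mul]
    exact mulVec_nonneg_of_nonneg h0 hs.1 i
  obtain ⟨⟨lam, x⟩, ⟨⟨⟨hlam, hlamC⟩, hx⟩, hle⟩, hmax⟩ :=
    hK.exists_isMaxOn hne continuous_fst.continuousOn
  simp only at hlam hlamC hx hle
  have heq : ∀ i, A.mulVec x i = lam * x i := by
    by_contra! hcon
    obtain ⟨i, hi⟩ := hcon
    obtain ⟨u, hxu, hu⟩ := hA.exists_mulVec_gt h0 hx.1 hle ⟨i, lt_of_le_of_ne (hle i) hi.symm⟩
    have hu0 : ∀ i, 0 ≤ u i := fun i => (hx.1 i).trans (hxu i)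
    have hsum : 1 ≤ ∑ i, u i := hx.2 ▸ Finset.sum_le_sum fun i _ => hxu i
    set s := ∑ i, u i with hs
    obtain ⟨i0, -, hi0⟩ := Finset.exists_min_image Finset.univ
      (fun i => A.mulVec u i - lam * u i) ⟨0, Finset.mem_univ _⟩
    set d := A.mulVec u i0 - lam * u i0 with hd
    have hdpos : 0 < d := sub_pos.2 (hu i0)
    have hus : ∀ i, u i ≤ s := fun i =>
      Finset.single_le_sum (fun i _ => hu0 i) (Finset.mem_univ i)
    have hs0 : 0 < s := by linarith
    have hv : s⁻¹ • u ∈ stdSimplex ℝ (Fin k) := by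
      refine ⟨fun i => mul_nonneg (inv_nonneg.2 hs0.le) (hu0 i), ?_⟩
      simp only [Pi.smul_apply, smul_eq_mul, ← Finset.mul_sum]
      exact inv_mul_cancel₀ hs0.ne'
    -- With `d` the least defect of `u` and `s` its coordinate sum, `u i ≤ s` leaves room to raise
    -- `λ` by `d / s`, against maximality.
    have hv' : ∀ i, (lam + d / s) * (s⁻¹ • u) i ≤ A.mulVec (s⁻¹ • u) i := by
      intro i
      rw [Matrix.mulVec_smul, Pi.smul_apply, Pi.smul_apply, smul_eq_mul, smul_eq_mul,
        mul_left_comm]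
      refine mul_le_mul_of_nonneg_left ?_ (inv_nonneg.2 hs0.le)
      have h1 : d ≤ A.mulVec u i - lam * u i := hi0 i (Finset.mem_univ i)
      have h2 : d / s * u i ≤ d := by
        rw [div_mul_eq_mul_div, div_le_iff₀ hs0]
        exact mul_le_mul_of_nonneg_left (hus i) hdpos.le
      linarith
    have hpos : 0 < d / s := div_pos hdpos hs0
    have hmem : ((lam + d / s, s⁻¹ • u) : ℝ × (Fin k → ℝ)) ∈ K :=
      ⟨⟨⟨by positivity, hbound _ _ hv hv'⟩, hv⟩, hv'⟩
    have : lam + d / s ≤ lam := hmax hmem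
    linarith
  refine ⟨lam, x, ?_, heq⟩
  have hN : {i | 0 < x i} = Set.univ := by
    apply hA
    · by_contra hcon
      have : ∀ i, x i = 0 := fun i => le_antisymm (not_lt.1 fun h => hcon ⟨i, h⟩) (hx.1 i)
      have h1 := hx.2
      simp [this] at h1
    · intro i hi j hj
      have h1 := mulVec_pos_of_pos h0 hx.1 hj hi
      rw [heq] at h1
      exact pos_of_mul_pos_right h1 hlam
  intro i
  have : i ∈ {i | 0 < x i} := hN ▸ Set.mem_univ i
  exact this

end PerronFrobenius

end Bootstrap

/-! ### Convexity and quasi-monotonicity of the vector field on `𝓓`. -/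

namespace Bootstrap

namespace LimitData

variable {k : ℕ}

/-- The properties of the limiting vector field that follow from the model assumptions. -/
structure Core [NeZero k] (P : LimitData k) : Prop where
  two_le : 2 ≤ P.r
  nonneg : ∀ i j, 0 ≤ P.chi i j
  diag : ∀ i, P.chi i i = 1
  symm_pos : ∀ i j, 0 < P.chi i j → 0 < P.chi j i
  irreducible : P.chi.IsIrreducible
  alpha_nonneg : ∀ i, 0 ≤ P.alpha i
  alpha_pos : 0 < P.alpha 0

/-- `∑_j χ_ij x_j`. -/
noncomputable def lin (P : LimitData k) (x : Vec k) (i : Fin k) : ℝ := ∑ j, P.chi i j * x j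

/-- The `i`-th component of the differential of `ρ` at `x` in direction `v`. -/
noncomputable def drho (P : LimitData k) (x v : Vec k) (i : Fin k) : ℝ :=
  - v i + P.c * (P.r * P.lin x i ^ (P.r - 1)) * P.lin v i

/-- Tangent inequality for the powers. -/
theorem pow_tangent_le {r : ℕ} (hr : 2 ≤ r) {a b : ℝ} (ha : 0 ≤ a) (hb : 0 ≤ b) :
    a ^ r + r * a ^ (r - 1) * (b - a) ≤ b ^ r := by
  rcases ha.eq_or_lt with rfl | ha
  · rw [zero_pow (by omega), zero_pow (by omega)]
    simpa using pow_nonneg hb r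
  -- Bernoulli's inequality for `b / a = 1 + (b / a - 1)`, multiplied by `a ^ r`.
  · have h := one_add_mul_le_pow (a := b / a - 1) (by have := div_nonneg hb ha.le; linarith) r
    have h1 : a ^ r = a ^ (r - 1) * a := by rw [← pow_succ]; congr 1; omega
    have h2 := mul_le_mul_of_nonneg_left h (pow_nonneg ha.le r)
    rw [add_sub_cancel, ← mul_pow, mul_div_cancel₀ _ ha.ne'] at h2
    refine le_trans (le_of_eq ?_) h2
    rw [mul_add, mul_one, h1]
    field_simp

section Basic

variable (P : LimitData k)

theorem rho_apply (x : Vec k) (i : Fin k) :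
    P.rho x i = P.alpha i - x i + P.c * P.lin x i ^ P.r := by
  simp only [rho, lin, mul_comm]

theorem lin_add (x y : Vec k) (i : Fin k) : P.lin (x + y) i = P.lin x i + P.lin y i := by
  simp [lin, mul_add, Finset.sum_add_distrib]

theorem lin_sub (x y : Vec k) (i : Fin k) : P.lin (x - y) i = P.lin x i - P.lin y i := by
  simp [lin, mul_sub, Finset.sum_sub_distrib]

theorem lin_smul (t : ℝ) (x : Vec k) (i : Fin k) : P.lin (t • x) i = t * P.lin x i := by
  simp [lin, Finset.mul_sum, mul_left_comm]

theorem drho_sub (x v w : Vec k) (i : Fin k) :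
    P.drho x (v - w) i = P.drho x v i - P.drho x w i := by
  simp only [drho, lin_sub, PiLp.sub_apply]
  ring

theorem drho_smul (x v : Vec k) (t : ℝ) (i : Fin k) :
    P.drho x (t • v) i = t * P.drho x v i := by
  simp only [drho, lin_smul, PiLp.smul_apply, smul_eq_mul]
  ring

theorem continuous_lin (i : Fin k) : Continuous fun x => P.lin x i := by
  unfold lin
  fun_prop

theorem continuous_rho_apply (i : Fin k) : Continuous fun x => P.rho x i := by
  simp only [rho_apply]
  have := P.continuous_lin i
  fun_prop

theorem contDiff_rho : ContDiff ℝ 1 P.rho := by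
  rw [contDiff_euclidean]
  intro i
  simp only [rho_apply, lin]
  fun_prop

/-- `lin` as a continuous linear form. -/
noncomputable def linCLM (i : Fin k) : Vec k →L[ℝ] ℝ := ∑ j, P.chi i j • EuclideanSpace.proj j

theorem linCLM_apply (i : Fin k) (x : Vec k) : P.linCLM i x = P.lin x i := by
  simp [linCLM, lin]

theorem hasFDerivAt_rho_apply (x : Vec k) (i : Fin k) :
    HasFDerivAt (fun y => P.rho y i) (-EuclideanSpace.proj i +
      (P.c * (P.r * P.lin x i ^ (P.r - 1))) • P.linCLM i : Vec k →L[ℝ] ℝ) x := by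
  simp only [rho_apply, ← linCLM_apply]
  have h1 : HasFDerivAt (fun y : Vec k => P.alpha i - y i)
      (-EuclideanSpace.proj i : Vec k →L[ℝ] ℝ) x :=
    ((EuclideanSpace.proj i : Vec k →L[ℝ] ℝ).hasFDerivAt).const_sub _
  have h2 := (((P.linCLM i).hasFDerivAt (x := x)).pow P.r).const_mul P.c
  refine (h1.add h2).congr_fderiv ?_
  rw [smul_smul, nsmul_eq_mul]

theorem fderiv_rho_apply (x v : Vec k) (i : Fin k) :
    fderiv ℝ (fun y => P.rho y i) x v = P.drho x v i := by
  rw [(P.hasFDerivAt_rho_apply x i).fderiv]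
  simp [linCLM_apply, drho]

theorem jacobian_mulVec (x v : Vec k) (i : Fin k) :
    ((P.jacobian x).mulVec v) i = P.drho x v i := by
  rw [← fderiv_rho_apply]
  have hv : v = ∑ j, v j • EuclideanSpace.single j (1 : ℝ) := by
    ext l
    simp [Finset.sum_apply, Pi.single_apply]
  conv_rhs => rw [hv]
  simp [jacobian, Matrix.mulVec, dotProduct, mul_comm]

theorem isPerronFrobenius_iff (x : Vec k) (lam : ℝ) (phi : Vec k) :
    IsPerronFrobenius (P.jacobian x) lam phi ↔
      (∀ i, 0 < phi i) ∧ ∀ i, P.drho x phi i = lam * phi i := by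
  simp only [IsPerronFrobenius, jacobian_mulVec]

end Basic

section Core

variable [NeZero k] {P : LimitData k} (hP : P.Core)
include hP

theorem Core.two_le_cast : (2 : ℝ) ≤ P.r := by exact_mod_cast hP.two_le

theorem Core.c_pos : 0 < P.c := by
  have h := hP.two_le_cast
  have h1 : (P.r : ℝ)⁻¹ < 1 := inv_lt_one_of_one_lt₀ (by linarith)
  have h2 : 0 < 1 - (P.r : ℝ)⁻¹ := by linarith
  have h3 : 0 < (P.r : ℝ)⁻¹ := by positivity
  exact mul_pos h3 (pow_pos h2 _)

theorem Core.top_pos : 0 < P.top := by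
  have h := hP.two_le_cast
  exact div_pos (by linarith) (by linarith)

theorem Core.lin_mono {x y : Vec k} (h : ∀ i, x i ≤ y i) (i : Fin k) : P.lin x i ≤ P.lin y i :=
  Finset.sum_le_sum fun j _ => mul_le_mul_of_nonneg_left (h j) (hP.nonneg i j)

theorem Core.lin_nonneg {x : Vec k} (h : ∀ i, 0 ≤ x i) (i : Fin k) : 0 ≤ P.lin x i :=
  Finset.sum_nonneg fun j _ => mul_nonneg (hP.nonneg i j) (h j)

theorem Core.le_lin {x : Vec k} (h : ∀ i, 0 ≤ x i) (i : Fin k) : x i ≤ P.lin x i := by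
  have := Finset.single_le_sum (f := fun j => P.chi i j * x j)
    (fun j _ => mul_nonneg (hP.nonneg i j) (h j)) (Finset.mem_univ i)
  simpa [hP.diag, lin] using this

theorem Core.lin_pos {x : Vec k} (h : ∀ i, 0 < x i) (i : Fin k) : 0 < P.lin x i :=
  (h i).trans_le (hP.le_lin (fun i => (h i).le) i)

theorem Core.lin_lt {x y : Vec k} (h : ∀ i, x i ≤ y i) {i j : Fin k} (hij : 0 < P.chi i j)
    (hj : x j < y j) : P.lin x i < P.lin y i :=
  Finset.sum_lt_sum (fun l _ => mul_le_mul_of_nonneg_left (h l) (hP.nonneg i l))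
    ⟨j, Finset.mem_univ j, mul_lt_mul_of_pos_left hj hij⟩

theorem Core.lin_lt_of_forall_lt {x y : Vec k} (h : ∀ i, x i < y i) (i : Fin k) :
    P.lin x i < P.lin y i :=
  hP.lin_lt (fun i => (h i).le) (hP.diag i ▸ one_pos) (h i)

theorem Core.rowSum_eq (x : Vec k) (i : Fin k) : P.rowSum x i = P.lin x i := by
  rw [rowSum, lin, ← Finset.add_sum_erase _ _ (Finset.mem_univ i), hP.diag, one_mul]

/-- Since `χ_ii = 1`, each coordinate of a nonnegative vector is at most its row sum, so the upper
bounds of the box are redundant. -/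
theorem Core.mem_D {x : Vec k} : x ∈ P.D ↔ (∀ i, 0 ≤ x i) ∧ ∀ i, P.lin x i ≤ P.top := by
  simp only [D, Set.mem_ofPred_eq, hP.rowSum_eq]
  constructor
  · rintro ⟨h1, h2⟩
    exact ⟨fun i => (h1 i).1, h2⟩
  · rintro ⟨h1, h2⟩
    exact ⟨fun i => ⟨h1 i, (hP.le_lin h1 i).trans (h2 i)⟩, h2⟩

theorem Core.mem_D_of_le {x y : Vec k} (hy : y ∈ P.D) (h0 : ∀ i, 0 ≤ x i)
    (h : ∀ i, x i ≤ y i) : x ∈ P.D :=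
  hP.mem_D.2 ⟨h0, fun i => (hP.lin_mono h i).trans ((hP.mem_D.1 hy).2 i)⟩

theorem Core.zero_mem_D : (0 : Vec k) ∈ P.D :=
  hP.mem_D.2 ⟨fun i => le_rfl, fun i => by simpa [lin] using hP.top_pos.le⟩

theorem Core.isClosed_D : IsClosed P.D := by
  have : P.D = {x | (∀ i, 0 ≤ x i) ∧ ∀ i, P.lin x i ≤ P.top} := Set.ext fun x => hP.mem_D
  rw [this, Set.ofPred_and, Set.ofPred_forall, Set.ofPred_forall]
  exact (isClosed_iInter fun i => isClosed_le continuous_const (by fun_prop)).inter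
    (isClosed_iInter fun i => isClosed_le (P.continuous_lin i) continuous_const)

theorem Core.isCompact_D : IsCompact P.D := by
  have h1 : IsCompact (WithLp.toLp 2 '' Set.Icc (0 : Fin k → ℝ) (fun _ => P.top)) :=
    isCompact_Icc.image (PiLp.continuous_toLp 2 _)
  refine h1.of_isClosed_subset hP.isClosed_D fun x hx => ?_
  exact ⟨WithLp.ofLp x, ⟨fun i => (hx.1 i).1, fun i => (hx.1 i).2⟩, rfl⟩

theorem Core.convex_D : Convex ℝ P.D := by
  intro x hx y hy a b ha hb hab
  rw [hP.mem_D] at *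
  refine ⟨fun i => ?_, fun i => ?_⟩
  · have := hx.1 i
    have := hy.1 i
    simp only [PiLp.add_apply, PiLp.smul_apply, smul_eq_mul]
    positivity
  · rw [lin_add, lin_smul, lin_smul]
    have h1 := mul_le_mul_of_nonneg_left (hx.2 i) ha
    have h2 := mul_le_mul_of_nonneg_left (hy.2 i) hb
    calc _ ≤ (a + b) * P.top := by linarith
      _ = P.top := by rw [hab, one_mul]

theorem Core.mem_interior_D {x : Vec k} (h0 : ∀ i, 0 < x i) (h : ∀ i, P.lin x i < P.top) :
    x ∈ interior P.D := by
  have ho : IsOpen {x : Vec k | (∀ i, 0 < x i) ∧ ∀ i, P.lin x i < P.top} := by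
    rw [Set.ofPred_and, Set.ofPred_forall, Set.ofPred_forall]
    exact (isOpen_iInter_of_finite fun i => isOpen_lt continuous_const (by fun_prop)).inter
      (isOpen_iInter_of_finite fun i => isOpen_lt (P.continuous_lin i) continuous_const)
  exact interior_maximal (fun y hy => hP.mem_D.2 ⟨fun i => (hy.1 i).le, fun i => (hy.2 i).le⟩)
    ho ⟨h0, h⟩

theorem Core.isCompact_Drho : IsCompact P.Drho := by
  have : P.Drho = P.D ∩ {x | ∀ i j, P.rho x i = P.rho x j} := rfl
  rw [this]
  apply hP.isCompact_D.inter_right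
  simp only [Set.ofPred_forall]
  exact isClosed_iInter fun i => isClosed_iInter fun j =>
    isClosed_eq (P.continuous_rho_apply i) (P.continuous_rho_apply j)

/-- Convexity: each component lies above its tangent at `x`. Based at a zero it bounds `ρ` from
below; based at the moved point it bounds the moved value from above. -/
theorem Core.drho_le {x y : Vec k} (hx : ∀ i, 0 ≤ x i) (hy : ∀ i, 0 ≤ y i) (i : Fin k) :
    P.drho x (y - x) i ≤ P.rho y i - P.rho x i := by
  have h := mul_le_mul_of_nonneg_left
    (pow_tangent_le hP.two_le (hP.lin_nonneg hx i) (hP.lin_nonneg hy i)) hP.c_pos.le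
  rw [drho, lin_sub, rho_apply, rho_apply, PiLp.sub_apply]
  linarith

/-- `ρ` is quasi-monotone. -/
theorem Core.rho_le_of_le {x y : Vec k} (hx : ∀ i, 0 ≤ x i) (h : ∀ i, x i ≤ y i) (i : Fin k) :
    P.rho x i + x i ≤ P.rho y i + y i := by
  have h1 := pow_le_pow_left₀ (hP.lin_nonneg hx i) (hP.lin_mono h i) P.r
  have h2 := mul_le_mul_of_nonneg_left h1 hP.c_pos.le
  rw [rho_apply, rho_apply]
  linarith

theorem Core.rho_lt_of_lt {x y : Vec k} (hx : ∀ i, 0 ≤ x i) (h : ∀ i, x i ≤ y i) {i j : Fin k}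
    (hij : 0 < P.chi i j) (hj : x j < y j) : P.rho x i + x i < P.rho y i + y i := by
  have h1 := pow_lt_pow_left₀ (hP.lin_lt h hij hj) (hP.lin_nonneg hx i)
    (by have := hP.two_le; omega : P.r ≠ 0)
  have h2 := mul_lt_mul_of_pos_left h1 hP.c_pos
  rw [rho_apply, rho_apply]
  linarith

/-- The Jacobian at a positive point has a positive eigenvector. -/
theorem Core.exists_isPerronFrobenius {x : Vec k} (hx : ∀ i, 0 < x i) :
    ∃ lam phi, IsPerronFrobenius (P.jacobian x) lam phi := by
  -- The Jacobian is `diag(f) χ - 1`. Positive row factors do not change the graph of `χ`, and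
  -- subtracting the identity shifts the eigenvalue by one.
  let f : Fin k → ℝ := fun i => P.c * (P.r * P.lin x i ^ (P.r - 1))
  have hf : ∀ i, 0 < f i := fun i => by
    have h1 := hP.lin_pos hx i
    have h2 := hP.c_pos
    have h3 := hP.two_le_cast
    have h4 : (0 : ℝ) < P.r := by linarith
    positivity
  have hA : Connects (Matrix.of fun i j => f i * P.chi i j) := by
    intro N hN h
    refine connects_of_isIrreducible hP.irreducible N hN fun i hi j hj => ?_
    exact h i hi j (mul_pos (hf j) hj)
  obtain ⟨lam, v, hv, hlam⟩ := hA.exists_pos_eigenvector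
    fun i j => mul_nonneg (hf i).le (hP.nonneg i j)
  refine ⟨lam - 1, WithLp.toLp 2 v, (P.isPerronFrobenius_iff _ _ _).2 ⟨hv, fun i => ?_⟩⟩
  have h1 := hlam i
  simp only [Matrix.mulVec, dotProduct, Matrix.of_apply, mul_assoc, ← Finset.mul_sum] at h1
  have h2 : P.lin (WithLp.toLp 2 v) i = ∑ j, P.chi i j * v j := rfl
  rw [drho, h2]
  change -v i + f i * _ = (lam - 1) * v i
  linarith

end Core

end LimitData

end Bootstrap

/-! ### Zeros of the vector field, negative values and the Perron-Frobenius eigenvalue. -/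

namespace Bootstrap

namespace LimitData

variable {k : ℕ} [NeZero k] {P : LimitData k} (hP : P.Core)
include hP

section Equilibria

/-- Below a point with `ρ ≤ -m` there is a point with `ρ = -m`. -/
theorem Core.exists_rho_eq {x : Vec k} (hx : x ∈ P.D) {m : ℝ} (hm : 0 ≤ m)
    (h : ∀ i, P.rho x i ≤ -m) :
    ∃ z ∈ P.D, (∀ i, z i ≤ x i) ∧ ∀ i, P.rho z i = -m := by
  let K : Set (Vec k) := P.D ∩ {z | ∀ i, z i ≤ x i ∧ P.rho z i ≤ -m}
  have hK : IsCompact K := by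
    apply hP.isCompact_D.inter_right
    rw [Set.ofPred_forall]
    refine isClosed_iInter fun i => ?_
    rw [Set.ofPred_and]
    exact (isClosed_le (by fun_prop) continuous_const).inter
      (isClosed_le (P.continuous_rho_apply i) continuous_const)
  obtain ⟨z, ⟨hzD, hz⟩, hmin⟩ := hK.exists_isMinOn (f := fun z : Vec k => ∑ i, z i)
    ⟨x, hx, fun i => ⟨le_rfl, h i⟩⟩ (by fun_prop)
  have hz0 := (hP.mem_D.1 hzD).1
  -- One step of the monotone iteration from the minimiser `z` of the coordinate sum. It stays in
  -- `K` and below `z`, so it must equal `z`, which says `ρ(z) = -m`.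
  let u : Vec k := WithLp.toLp 2 fun i => P.rho z i + z i + m
  have hu : ∀ i, u i = P.rho z i + z i + m := fun i => rfl
  have huz : ∀ i, u i ≤ z i := fun i => by linarith [hu i, (hz i).2]
  have hu0 : ∀ i, 0 ≤ u i := fun i => by
    have h1 := pow_nonneg (hP.lin_nonneg hz0 i) P.r
    have h2 := mul_nonneg hP.c_pos.le h1
    rw [hu, rho_apply]
    linarith [hP.alpha_nonneg i]
  have huK : u ∈ K := by
    refine ⟨hP.mem_D_of_le hzD hu0 huz, fun i => ⟨(huz i).trans (hz i).1, ?_⟩⟩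
    have := hP.rho_le_of_le hu0 huz i
    linarith [hu i]
  have hsum : ∑ i, z i ≤ ∑ i, u i := hmin huK
  refine ⟨z, hzD, fun i => (hz i).1, fun i => ?_⟩
  have := (Finset.sum_eq_sum_iff_of_le fun i _ => huz i).1
    (le_antisymm (Finset.sum_le_sum fun i _ => huz i) hsum) i (Finset.mem_univ i)
  linarith [hu i]

/-- If `-m` is the largest component of a negative value of `ρ`, then `exists_rho_eq` gives a point
of `𝓓_ρ` with common value `-m`; compactness of `𝓓_ρ` gives the minimum. -/
theorem Core.minSub_iff : P.MinSub ↔ P.Sub := by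
  constructor
  · rintro ⟨m, hm, ⟨x, hx, rfl⟩, -⟩
    exact ⟨x, hx.1, fun i => (hx.2 i 0).trans_lt hm⟩
  · rintro ⟨x, hx, h⟩
    obtain ⟨i0, -, hi0⟩ := Finset.exists_max_image Finset.univ (fun i => P.rho x i)
      ⟨0, Finset.mem_univ _⟩
    obtain ⟨z, hz, -, hzm⟩ := hP.exists_rho_eq hx (m := -P.rho x i0) (by linarith [h i0])
      fun i => by linarith [hi0 i (Finset.mem_univ i)]
    have hzD : z ∈ P.Drho := ⟨hz, fun i j => by rw [hzm, hzm]⟩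
    obtain ⟨y, hy, hmin⟩ := hP.isCompact_Drho.exists_isMinOn ⟨z, hzD⟩
      (P.continuous_rho_apply 0).continuousOn
    refine ⟨P.rho y 0, ?_, ⟨y, hy, rfl⟩, ?_⟩
    · have : P.rho y 0 ≤ P.rho z 0 := hmin hzD
      linarith [hzm 0, h i0]
    · rintro _ ⟨w, hw, rfl⟩
      exact hmin hw

omit hP [NeZero k] in
theorem sup_iff : P.Sup ↔ P.zeros = ∅ := by
  rw [Set.eq_empty_iff_forall_notMem]
  constructor
  · rintro h x ⟨hx, h0⟩
    exact h x hx (by ext i; exact h0 i)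
  · intro h x hx h0
    exact h x ⟨hx, fun i => by rw [h0]; rfl⟩

theorem Core.zeros_nonempty_of_sub (h : P.Sub) : P.zeros.Nonempty := by
  obtain ⟨x, hx, h⟩ := h
  obtain ⟨z, hz, -, h0⟩ := hP.exists_rho_eq hx le_rfl fun i => by linarith [h i]
  exact ⟨z, hz, fun i => by simpa using h0 i⟩

theorem Core.minSup_iff : P.MinSup ↔ P.Sup := by
  rw [sup_iff]
  constructor
  · intro h
    rw [Set.eq_empty_iff_forall_notMem]
    rintro x ⟨hx, h0⟩
    have hx' : x ∈ P.Drho := ⟨hx, fun i j => by rw [h0, h0]⟩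
    rcases h with h | ⟨m, hm, -, hmin⟩
    · simp [h] at hx'
    · have := hmin ⟨x, hx', rfl⟩
      simp only [h0] at this
      linarith
  · intro h
    rcases P.Drho.eq_empty_or_nonempty with he | hne
    · exact Or.inl he
    · right
      obtain ⟨y, hy, hmin⟩ := hP.isCompact_Drho.exists_isMinOn hne
        (P.continuous_rho_apply 0).continuousOn
      refine ⟨P.rho y 0, ?_, ⟨y, hy, rfl⟩, ?_⟩
      · by_contra hcon
        obtain ⟨z, hz, -, h0⟩ := hP.exists_rho_eq hy.1 le_rfl fun i => by
          rw [hy.2 i 0]; linarith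
        have : z ∈ P.zeros := ⟨hz, fun i => by simpa using h0 i⟩
        simp [h] at this
      · rintro _ ⟨w, hw, rfl⟩
        exact hmin hw

/-- Zeros are exactly the points of `𝓓_ρ` with value `0`, and a point of `𝓓_ρ` with a negative value
is negative in all components. -/
theorem Core.minCrit_iff : P.MinCrit ↔ P.zeros.Nonempty ∧ ¬ P.Sub := by
  constructor
  · rintro ⟨⟨x, hx, h0⟩, hmin⟩
    refine ⟨⟨x, hx.1, fun i => (hx.2 i 0).trans h0⟩, fun hS => ?_⟩
    obtain ⟨m, hm, hm', -⟩ := hP.minSub_iff.2 hS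
    exact absurd (hmin hm') (not_le.2 hm)
  · rintro ⟨⟨z, hz, h0⟩, hS⟩
    refine ⟨⟨z, ⟨hz, fun i j => by rw [h0, h0]⟩, h0 0⟩, ?_⟩
    rintro _ ⟨y, hy, rfl⟩
    by_contra hcon
    exact hS ⟨y, hy.1, fun i => (hy.2 i 0).trans_lt (not_le.1 hcon)⟩

/-- If `ρ(x) ≤ 0` and `ρ(x) ≠ 0`, then `ρ < 0` at some point below `x`. -/
theorem Core.exists_rho_neg {x : Vec k} (h0 : ∀ i, 0 ≤ x i) (hle : ∀ i, P.rho x i ≤ 0)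
    (hne : ∃ i, P.rho x i < 0) :
    ∃ y : Vec k, (∀ i, 0 ≤ y i) ∧ (∀ i, y i ≤ x i) ∧ ∀ i, P.rho y i < 0 := by
  -- The step is halved so that negative components stay negative: the new `ρ` is at most half the
  -- old one, whereas a full step would only keep `ρ ≤ 0`. A decrease of `u j` makes `ρ_i` negative
  -- at the next step when `χ_ij > 0`.
  let G : Vec k → Vec k := fun y => y + (2⁻¹ : ℝ) • P.rho y
  let u : ℕ → Vec k := fun n => G^[n] x
  have hu : ∀ n i, u (n + 1) i = u n i + 2⁻¹ * P.rho (u n) i := fun n i => by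
    simp only [u, Function.iterate_succ_apply', G, PiLp.add_apply, PiLp.smul_apply, smul_eq_mul]
  have step : ∀ n, (∀ i, 0 ≤ u n i) → (∀ i, P.rho (u n) i ≤ 0) →
      (∀ i, 0 ≤ u (n + 1) i) ∧ ∀ i, P.rho (u (n + 1)) i ≤ 2⁻¹ * P.rho (u n) i := by
    intro n h1 h2
    have h3 : ∀ i, 0 ≤ u (n + 1) i := fun i => by
      have h4 := pow_nonneg (hP.lin_nonneg h1 i) P.r
      have h5 := mul_nonneg hP.c_pos.le h4
      rw [hu, rho_apply]
      linarith [hP.alpha_nonneg i, h1 i]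
    refine ⟨h3, fun i => ?_⟩
    have := hP.rho_le_of_le h3 (y := u n) (fun j => by linarith [hu n j, h2 j]) i
    linarith [hu n i]
  have hall : ∀ n, (∀ i, 0 ≤ u n i) ∧ (∀ i, u n i ≤ x i) ∧ ∀ i, P.rho (u n) i ≤ 0 := by
    intro n
    induction n with
    | zero => exact ⟨h0, fun i => le_rfl, hle⟩
    | succ n ih =>
      obtain ⟨h1, h2⟩ := step n ih.1 ih.2.2
      exact ⟨h1, fun i => by linarith [hu n i, ih.2.1 i, ih.2.2 i],
        fun i => by linarith [h2 i, ih.2.2 i]⟩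
  obtain ⟨n, hn⟩ := (connects_of_isIrreducible hP.irreducible).exists_eq_univ
    (fun n => {i | P.rho (u n) i < 0})
    (fun n i hi => by
      have := (step n (hall n).1 (hall n).2.2).2 i
      simp only [Set.mem_ofPred_eq] at hi ⊢
      linarith)
    (fun n i hi j hj => by
      simp only [Set.mem_ofPred_eq] at hi ⊢
      have := hP.rho_lt_of_lt (hall (n + 1)).1 (y := u n)
        (fun j => by linarith [hu n j, (hall n).2.2 j]) hj (by linarith [hu n i])
      linarith [hu n j, (hall n).2.2 j])
    hne
  refine ⟨u n, (hall n).1, (hall n).2.1, fun i => ?_⟩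
  have : i ∈ {i | P.rho (u n) i < 0} := hn ▸ Set.mem_univ i
  exact this

/-- From `z_i ≥ α_i + c (∑_j χ_ij z_j)^r`, positivity starts at community `0`, where `α > 0`, and
travels along the edges. -/
theorem Core.pos_of_rho_nonpos {z : Vec k} (h0 : ∀ i, 0 ≤ z i) (hz : ∀ i, P.rho z i ≤ 0)
    (i : Fin k) : 0 < z i := by
  have key : ∀ i, P.alpha i + P.c * P.lin z i ^ P.r ≤ z i := fun i => by
    have := hz i
    rw [rho_apply] at this
    linarith
  have hN : {i | 0 < z i} = Set.univ := by
    apply connects_of_isIrreducible hP.irreducible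
    · refine ⟨0, lt_of_lt_of_le ?_ (key 0)⟩
      have := mul_nonneg hP.c_pos.le (pow_nonneg (hP.lin_nonneg h0 0) P.r)
      linarith [hP.alpha_pos]
    · intro i hi j hj
      refine lt_of_lt_of_le ?_ (key j)
      have h1 : 0 < P.lin z j := Finset.sum_pos' (fun l _ => mul_nonneg (hP.nonneg j l) (h0 l))
        ⟨i, Finset.mem_univ i, mul_pos hj hi⟩
      have := mul_pos hP.c_pos (pow_pos h1 P.r)
      linarith [hP.alpha_nonneg j]
  have : i ∈ {i | 0 < z i} := hN ▸ Set.mem_univ i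
  exact this

/-- By continuity the derivative along `v` is still negative at `x + t v` for small `t`; the tangent
there, evaluated back at `x`, gives `ρ(x + t v) ≤ ρ(x) + t drho(x + t v, v) < 0`. -/
theorem Core.exists_rho_neg_of_drho_neg {x v : Vec k} (hx : ∀ i, 0 ≤ x i)
    (hfeas : ∀ᶠ t in 𝓝[>] (0 : ℝ), x + t • v ∈ P.D) (hle : ∀ i, P.rho x i ≤ 0)
    (hv : ∀ i, P.drho x v i < 0) :
    ∃ t : ℝ, 0 < t ∧ x + t • v ∈ P.D ∧ ∀ i, P.rho (x + t • v) i < 0 := by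
  have h1 : ∀ᶠ t in 𝓝[>] (0 : ℝ), ∀ i, P.drho (x + t • v) v i < 0 := by
    refine eventually_all.2 fun i => ?_
    have hc : Continuous fun t : ℝ => P.drho (x + t • v) v i := by
      unfold drho
      have := P.continuous_lin i
      fun_prop
    have := hc.tendsto 0
    rw [zero_smul, add_zero] at this
    exact (this.eventually (gt_mem_nhds (hv i))).filter_mono nhdsWithin_le_nhds
  obtain ⟨t, ⟨ht1, ht2⟩, ht⟩ := ((hfeas.and h1).and self_mem_nhdsWithin).exists
  refine ⟨t, ht, ht1, fun i => ?_⟩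
  have h2 := hP.drho_le (hP.mem_D.1 ht1).1 hx i
  have h3 : x - (x + t • v) = (-t) • v := by simp
  rw [h3, drho_smul] at h2
  have h4 : t * P.drho (x + t • v) v i < 0 := mul_neg_of_pos_of_neg ht (ht2 i)
  linarith [hle i]

theorem Core.sub_of_pos_eigenvalue {z phi : Vec k} {lam : ℝ} (hz : z ∈ P.zeros)
    (hphi : IsPerronFrobenius (P.jacobian z) lam phi) (hlam : 0 < lam) : P.Sub := by
  rw [isPerronFrobenius_iff] at hphi
  have hz0 := (hP.mem_D.1 hz.1).1
  have hzpos := hP.pos_of_rho_nonpos hz0 fun i => (hz.2 i).le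
  have hfeas : ∀ᶠ t in 𝓝[>] (0 : ℝ), z + t • (-phi) ∈ P.D := by
    have h1 : ∀ᶠ t in 𝓝[>] (0 : ℝ), ∀ i, 0 < (z + t • (-phi)) i := by
      refine eventually_all.2 fun i => ?_
      have hc : Continuous fun t : ℝ => (z + t • (-phi)) i := by fun_prop
      have := hc.tendsto 0
      rw [zero_smul, add_zero] at this
      exact (this.eventually (lt_mem_nhds (hzpos i))).filter_mono nhdsWithin_le_nhds
    filter_upwards [h1, self_mem_nhdsWithin] with t ht ht0
    refine hP.mem_D_of_le hz.1 (fun i => (ht i).le) fun i => ?_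
    have := mul_pos (Set.mem_Ioi.1 ht0) (hphi.1 i)
    simp only [PiLp.add_apply, PiLp.smul_apply, PiLp.neg_apply, smul_eq_mul]
    linarith
  obtain ⟨t, -, ht, h⟩ := hP.exists_rho_neg_of_drho_neg hz0 hfeas (fun i => (hz.2 i).le)
    fun i => by
      have := mul_pos hlam (hphi.1 i)
      have h2 := P.drho_smul z phi (-1) i
      rw [neg_one_smul] at h2
      linarith [hphi.2 i]
  exact ⟨_, ht, h⟩

theorem Core.exists_rho_neg_of_neg_eigenvalue {z phi : Vec k} {lam : ℝ} (hz : z ∈ P.zeros)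
    (hint : z ∈ interior P.D) (hphi : IsPerronFrobenius (P.jacobian z) lam phi) (hlam : lam < 0) :
    ∃ t : ℝ, 0 < t ∧ z + t • phi ∈ P.D ∧ ∀ i, P.rho (z + t • phi) i < 0 := by
  rw [isPerronFrobenius_iff] at hphi
  refine hP.exists_rho_neg_of_drho_neg (hP.mem_D.1 hz.1).1 ?_ (fun i => (hz.2 i).le) fun i => by
    rw [hphi.2]; exact mul_neg_of_neg_of_pos hlam (hphi.1 i)
  have hc : Continuous fun t : ℝ => z + t • phi := by fun_prop
  have := hc.tendsto 0
  rw [zero_smul, add_zero] at this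
  exact (this.eventually (mem_interior_iff_mem_nhds.1 hint)).filter_mono nhdsWithin_le_nhds

theorem Core.eigenvalue_eq_zero {z phi : Vec k} {lam : ℝ} (hS : ¬ P.Sub) (hz : z ∈ P.zeros)
    (hint : z ∈ interior P.D) (hphi : IsPerronFrobenius (P.jacobian z) lam phi) : lam = 0 := by
  rcases lt_trichotomy lam 0 with h | h | h
  · obtain ⟨t, -, ht, h⟩ := hP.exists_rho_neg_of_neg_eigenvalue hz hint hphi h
    exact absurd ⟨_, ht, h⟩ hS
  · exact h
  · exact absurd (hP.sub_of_pos_eigenvalue hz hphi h) hS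

/-- Comparison of a vector with a positive eigenvector of the Jacobian. -/
theorem Core.exists_le_drho {z phi : Vec k} {lam : ℝ} (hz : ∀ i, 0 ≤ z i)
    (hphi : IsPerronFrobenius (P.jacobian z) lam phi) (v : Vec k) :
    ∃ i t, v i = t * phi i ∧ t * (lam * phi i) ≤ P.drho z v i := by
  rw [isPerronFrobenius_iff] at hphi
  -- At an index minimising `v i / phi i`, the vector `v - t phi` is nonnegative and vanishes in
  -- component `i`, so only nonnegative terms of the Jacobian row act on it.
  obtain ⟨i, -, hi⟩ := Finset.exists_min_image Finset.univ (fun i => v i / phi i)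
    ⟨0, Finset.mem_univ _⟩
  have heq : v i = v i / phi i * phi i := (div_mul_cancel₀ _ (hphi.1 i).ne').symm
  refine ⟨i, v i / phi i, heq, ?_⟩
  set t := v i / phi i
  have hw : ∀ j, 0 ≤ (v - t • phi) j := fun j => by
    have := (le_div_iff₀ (hphi.1 j)).1 (hi j (Finset.mem_univ j))
    simpa using this
  have h1 := hP.lin_nonneg hw i
  have h2 : 0 ≤ P.drho z (v - t • phi) i := by
    have h3 := hP.lin_nonneg hz i
    have h4 := hP.c_pos
    have h5 : (v - t • phi) i = 0 := by simp [← heq]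
    rw [drho, h5]
    positivity
  rw [drho_sub, drho_smul, hphi.2] at h2
  linarith

/-- Convexity gives `drho z (w - z) ≤ ρ(w) < 0` in all components. As `w - z ≥ 0`, comparison with
`phi` has factor `t ≥ 0`, which is impossible for `lam ≥ 0`. -/
theorem Core.eigenvalue_neg {z w phi : Vec k} {lam : ℝ} (hz : z ∈ P.zeros)
    (hw : ∀ i, P.rho w i < 0) (hzw : ∀ i, z i ≤ w i)
    (hphi : IsPerronFrobenius (P.jacobian z) lam phi) : lam < 0 := by
  have hz0 := (hP.mem_D.1 hz.1).1
  obtain ⟨i, t, hi, ht⟩ := hP.exists_le_drho hz0 hphi (w - z)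
  have h1 := hP.drho_le hz0 (fun i => (hz0 i).trans (hzw i)) i
  have hpos := hphi.1 i
  have ht0 : 0 ≤ t := by
    have : 0 ≤ t * phi i := by
      rw [← hi, PiLp.sub_apply]
      linarith [hzw i]
    exact nonneg_of_mul_nonneg_left this hpos
  by_contra hcon
  have : 0 ≤ t * (lam * phi i) := mul_nonneg ht0 (mul_nonneg (not_lt.1 hcon) hpos.le)
  linarith [hw i, hz.2 i]

/-- If `ρ` has no negative value on `𝓓`, then the zero is unique. -/
theorem Core.zeros_subsingleton (hS : ¬ P.Sub) : P.zeros.Subsingleton := by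
  intro z hz w hw
  by_contra hne
  have hz0 := (hP.mem_D.1 hz.1).1
  have hw0 := (hP.mem_D.1 hw.1).1
  let m : Vec k := (2⁻¹ : ℝ) • z + (2⁻¹ : ℝ) • w
  have hmD : m ∈ P.D := hP.convex_D hz.1 hw.1 (by norm_num) (by norm_num) (by norm_num)
  have hlin : ∀ i, P.lin m i = 2⁻¹ * P.lin z i + 2⁻¹ * P.lin w i := fun i => by
    rw [lin_add, lin_smul, lin_smul]
  have hmi : ∀ i, m i = 2⁻¹ * z i + 2⁻¹ * w i := fun i => by simp [m]
  have hval : ∀ i, P.rho m i = P.c * ((2⁻¹ * P.lin z i + 2⁻¹ * P.lin w i) ^ P.r -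
      (2⁻¹ * P.lin z i ^ P.r + 2⁻¹ * P.lin w i ^ P.r)) := fun i => by
    have h1 := hz.2 i
    have h2 := hw.2 i
    rw [rho_apply] at h1 h2 ⊢
    rw [hlin, hmi]
    linear_combination (2⁻¹ : ℝ) * h1 + (2⁻¹ : ℝ) * h2
  have hconv := strictConvexOn_pow hP.two_le
  have hle : ∀ i, P.rho m i ≤ 0 := fun i => by
    rw [hval]
    refine mul_nonpos_of_nonneg_of_nonpos hP.c_pos.le (sub_nonpos.2 ?_)
    have := hconv.convexOn.2 (Set.mem_Ici.2 (hP.lin_nonneg hz0 i))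
      (Set.mem_Ici.2 (hP.lin_nonneg hw0 i)) (by norm_num : (0 : ℝ) ≤ 2⁻¹)
      (by norm_num : (0 : ℝ) ≤ 2⁻¹) (by norm_num)
    simpa using this
  have hex : ∃ i, P.rho m i < 0 := by
    -- At a zero the row sum determines the coordinate, so distinct zeros differ in some row sum,
    -- where strict convexity of the power applies to the midpoint.
    have : ∃ i, P.lin z i ≠ P.lin w i := by
      by_contra! hcon
      refine hne (PiLp.ext fun i => ?_)
      have h1 := hz.2 i
      have h2 := hw.2 i
      rw [rho_apply] at h1 h2
      rw [hcon] at h1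
      linarith
    obtain ⟨i, hi⟩ := this
    refine ⟨i, ?_⟩
    rw [hval]
    refine mul_neg_of_pos_of_neg hP.c_pos (sub_neg.2 ?_)
    have := hconv.2 (Set.mem_Ici.2 (hP.lin_nonneg hz0 i))
      (Set.mem_Ici.2 (hP.lin_nonneg hw0 i)) hi (by norm_num : (0 : ℝ) < 2⁻¹)
      (by norm_num : (0 : ℝ) < 2⁻¹) (by norm_num)
    simpa using this
  obtain ⟨y, hy0, hym, hy⟩ := hP.exists_rho_neg (hP.mem_D.1 hmD).1 hle hex
  exact hS ⟨y, hP.mem_D_of_le hmD hy0 hym, hy⟩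

/-- The number `r / (r - 1)` is where `s ↦ c s ^ r` has slope one; on `𝓓̃` this cancels the diagonal
term of the Jacobian. -/
theorem Core.c_mul_top_pow : P.c * (P.r * P.top ^ (P.r - 1)) = 1 := by
  have h := hP.two_le_cast
  have h1 : (P.r : ℝ) ≠ 0 := by positivity
  have h2 : (P.r : ℝ) - 1 ≠ 0 := by linarith
  have h3 : (1 - (P.r : ℝ)⁻¹) * P.top = 1 := by
    rw [top]
    field_simp
  calc P.c * (P.r * P.top ^ (P.r - 1))
      = (P.r : ℝ)⁻¹ * P.r * ((1 - (P.r : ℝ)⁻¹) * P.top) ^ (P.r - 1) := by rw [c, mul_pow]; ring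
    _ = 1 := by rw [h3, one_pow, inv_mul_cancel₀ h1, mul_one]

theorem Core.exists_ne_chi_pos (hk : 2 ≤ k) (i : Fin k) : ∃ j, j ≠ i ∧ 0 < P.chi i j := by
  by_contra! hcon
  have h1 : ({i} : Set (Fin k)) = Set.univ := by
    refine connects_of_isIrreducible hP.irreducible _ ⟨i, rfl⟩ fun l hl j hj => ?_
    rw [Set.mem_singleton_iff] at hl ⊢
    subst hl
    by_contra hne
    exact absurd (hP.symm_pos _ _ hj) (not_lt.2 (hcon j hne))
  have : Nontrivial (Fin k) := Fin.nontrivial_iff_two_le.2 hk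
  obtain ⟨j, hj⟩ := exists_ne i
  exact hj (h1 ▸ Set.mem_univ j : j ∈ ({i} : Set (Fin k)))

/-- If row sum `i` were `r / (r - 1)`, row `i` of the eigenvalue equation would read `λ φ_i = ∑_{j ≠
i} χ_ij φ_j > 0`, and a positive eigenvalue produces a point with `ρ < 0`. For `k = 1` the sum is
empty. -/
theorem Core.zero_mem_interior (hk : 2 ≤ k) (hS : ¬ P.Sub) {z : Vec k} (hz : z ∈ P.zeros) :
    z ∈ interior P.D := by
  have hzpos := hP.pos_of_rho_nonpos (hP.mem_D.1 hz.1).1 fun i => (hz.2 i).le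
  refine hP.mem_interior_D hzpos fun i => lt_of_le_of_ne ((hP.mem_D.1 hz.1).2 i) fun htop => hS ?_
  obtain ⟨lam, phi, hphi⟩ := hP.exists_isPerronFrobenius hzpos
  refine hP.sub_of_pos_eigenvalue hz hphi ?_
  obtain ⟨j, hji, hj⟩ := hP.exists_ne_chi_pos hk i
  rw [isPerronFrobenius_iff] at hphi
  have h1 := hphi.2 i
  rw [drho, htop, hP.c_mul_top_pow, one_mul] at h1
  have h2 : phi i < P.lin phi i := by
    rw [lin, ← Finset.add_sum_erase _ _ (Finset.mem_univ i), hP.diag, one_mul]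
    have : 0 < ∑ l ∈ Finset.univ.erase i, P.chi i l * phi l :=
      Finset.sum_pos' (fun l _ => mul_nonneg (hP.nonneg i l) (hphi.1 l).le)
        ⟨j, by simp [hji], mul_pos hj (hphi.1 j)⟩
    linarith
  have h3 : 0 < lam * phi i := by linarith
  exact pos_of_mul_pos_left h3 (hphi.1 i).le

theorem Core.crit_of_minCrit (hk : 2 ≤ k) (h : P.MinCrit) : P.Crit := by
  obtain ⟨⟨z, hz⟩, hS⟩ := hP.minCrit_iff.1 h
  have hint := hP.zero_mem_interior hk hS hz
  have hzpos := hP.pos_of_rho_nonpos (hP.mem_D.1 hz.1).1 fun i => (hz.2 i).le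
  obtain ⟨lam, phi, hphi⟩ := hP.exists_isPerronFrobenius hzpos
  obtain rfl := hP.eigenvalue_eq_zero hS hz hint hphi
  refine ⟨z, (hP.zeros_subsingleton hS).eq_singleton_of_mem hz, hint, ?_, phi, hphi⟩
  rw [← Matrix.exists_mulVec_eq_zero_iff]
  refine ⟨WithLp.ofLp phi, fun h0 => ?_, funext fun i => ?_⟩
  · have := hphi.1 0
    rw [h0] at this
    simp at this
  · simpa using hphi.2 i

/-- With eigenvalue `0`, every direction has a component in which the derivative at `z` is
nonnegative; by convexity no `x` in `𝓓` has all `ρ_i(x) < 0`. -/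
theorem Core.minCrit_of_crit (h : P.Crit) : P.MinCrit := by
  obtain ⟨z, hz, -, -, phi, hphi⟩ := h
  have hzm : z ∈ P.zeros := hz ▸ rfl
  have hz0 := (hP.mem_D.1 hzm.1).1
  refine hP.minCrit_iff.2 ⟨⟨z, hzm⟩, ?_⟩
  rintro ⟨x, hx, h⟩
  obtain ⟨i, t, -, ht⟩ := hP.exists_le_drho hz0 hphi (x - z)
  have h1 := hP.drho_le hz0 (hP.mem_D.1 hx).1 i
  rw [zero_mul, mul_zero] at ht
  linarith [h i, hzm.2 i]

end Equilibria

end LimitData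

end Bootstrap

/-! ### From the block model to the limiting vector field. -/

namespace Bootstrap

theorem ModelAssumptions.core {k : ℕ} [NeZero k] {r : ℕ} {M : SBMSequence k}
    {nu gam mu : Fin k → Fin k → ℝ} {alpha : Fin k → ℝ}
    (hM : ModelAssumptions r M nu gam mu alpha) :
    (⟨r, chiMatrix r nu gam mu, alpha⟩ : LimitData k).Core := by
  have hsize : ∀ i, ∀ᶠ n in atTop, (M.size n i : ℝ) ≠ 0 := fun i => by
    filter_upwards [hM.size_pos] with n hn
    have := hn i
    exact_mod_cast (by omega : M.size n i ≠ 0)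
  -- `1 / n_i = o(p_i)` forces `p_i ≠ 0` eventually, because `1 / n_i` does not vanish.
  have hp : ∀ i, ∀ᶠ n in atTop, M.p n i ≠ 0 := fun i => by
    filter_upwards [(hM.p_lower i).isBigO.eq_zero_imp, hsize i] with n h1 h2 h3
    exact h2 (by simpa using h1 h3)
  have hnu : ∀ i, nu i i = 1 := fun i => by
    refine tendsto_nhds_unique (hM.tendsto_nu i i) (tendsto_const_nhds.congr' ?_)
    filter_upwards [hsize i] with n hn
    rw [div_self hn]
  have hmu : ∀ i, mu i i = 1 := fun i => by
    refine tendsto_nhds_unique (hM.tendsto_mu i i) (tendsto_const_nhds.congr' ?_)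
    filter_upwards [hp i] with n hn
    rw [div_self hn]
  have hgam : ∀ i, gam i i = 1 := fun i => by
    refine tendsto_nhds_unique (hM.tendsto_gam i i) (tendsto_const_nhds.congr' ?_)
    filter_upwards [hp i] with n hn
    exact (div_self hn).symm
  -- `q_ji / p_j = (q_ij / p_i) (p_i / p_j)`; so `χ` need not be symmetric, but its support is.
  have hsymm : ∀ i j, gam j i = gam i j * mu i j := fun i j => by
    refine tendsto_nhds_unique (hM.tendsto_gam j i)
      (((hM.tendsto_gam i j).mul (hM.tendsto_mu i j)).congr' ?_)
    filter_upwards [hp i, hp j, hM.q_symm] with n h1 h2 h3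
    rw [h3 i j]
    field_simp
  have hpos : ∀ i j, 0 < (nu i j * mu i j ^ r) ^ (1 / ((r : ℝ) - 1)) := fun i j =>
    Real.rpow_pos_of_pos (mul_pos (hM.nu_pos i j) (pow_pos (hM.mu_pos i j) r)) _
  refine ⟨hM.two_le_r, fun i j => mul_nonneg (hM.gam_mem i j).1 (hpos i j).le, fun i => ?_,
    fun i j hij => ?_, hM.irreducible, hM.alpha_nonneg, hM.alpha_zero_pos⟩
  · simp [chiMatrix, hnu, hmu, hgam]
  · have h1 : 0 < gam i j := pos_of_mul_pos_left hij (hpos i j).le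
    refine mul_pos ?_ (hpos j i)
    rw [hsymm i j]
    exact mul_pos h1 (hM.mu_pos i j)

namespace LimitData

variable {k : ℕ} [NeZero k] {P : LimitData k} (hP : P.Core)
include hP

/-! ### Shells around the first community and the initial point. -/

section InitialPoint

theorem Core.chiMin_mem : P.chiMin ∈ {t | 0 < t ∧ ∃ i j, P.chi i j = t} := by
  apply Set.Nonempty.csInf_mem
  · exact ⟨1, one_pos, 0, 0, hP.diag 0⟩
  · refine (Set.finite_range fun p : Fin k × Fin k => P.chi p.1 p.2).subset ?_
    rintro _ ⟨-, i, j, rfl⟩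
    exact ⟨(i, j), rfl⟩

omit hP [NeZero k] in
theorem chiMin_le {i j : Fin k} (h : 0 < P.chi i j) : P.chiMin ≤ P.chi i j :=
  csInf_le ⟨0, fun _ ht => ht.1.le⟩ ⟨h, i, j, rfl⟩

theorem Core.beta_pos (h : ℕ) : 0 < P.beta h := by
  induction h with
  | zero => exact half_pos hP.alpha_pos
  | succ h ih =>
    have h1 := hP.chiMin_mem.1
    have h2 := hP.c_pos
    rw [beta]
    positivity

theorem Core.pow_nonneg (m : ℕ) (i j : Fin k) : 0 ≤ (P.chi ^ m) i j :=
  Matrix.pow_apply_nonneg hP.nonneg m i j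

theorem Core.exists_mem_shell (i : Fin k) : ∃ h, i ∈ P.shell h := by
  by_cases hi : i = 0
  · exact ⟨0, hi⟩
  · have hex := (Matrix.isIrreducible_iff_exists_pow_pos hP.nonneg).1 hP.irreducible 0 i
    classical
    obtain ⟨hpos, hfind⟩ := Nat.find_spec hex
    obtain ⟨h, hh⟩ : ∃ h, Nat.find hex = h + 1 := ⟨Nat.find hex - 1, by omega⟩
    rw [hh] at hfind
    refine ⟨h + 1, hi, hfind, fun s hs1 hs2 => ?_⟩
    have := Nat.find_min hex (m := s) (by omega)
    by_contra hne
    exact this ⟨by omega, lt_of_le_of_ne (hP.pow_nonneg s 0 i) (Ne.symm hne)⟩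

omit hP in
theorem shell_unique {i : Fin k} {h h' : ℕ} (hi : i ∈ P.shell h) (hi' : i ∈ P.shell h') :
    h = h' := by
  wlog hle : h < h' generalizing h h'
  · rcases (not_lt.1 hle).eq_or_lt with h1 | h1
    · exact h1.symm
    · exact (this hi' hi h1).symm
  obtain ⟨m, rfl⟩ : ∃ m, h' = m + 1 := ⟨h' - 1, by omega⟩
  obtain ⟨h1, -, h3⟩ := hi'
  cases h with
  | zero => exact absurd hi h1
  | succ h => exact absurd (h3 (h + 1) (by omega) (by omega)) hi.2.1.ne'

/-- The last vertex before `i` on a shortest walk lies in the preceding shell; a shorter walk to it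
would shorten the walk to `i`. -/
theorem Core.exists_pred_shell {i : Fin k} {h : ℕ} (hi : i ∈ P.shell (h + 1)) :
    ∃ j ∈ P.shell h, 0 < P.chi i j := by
  obtain ⟨hi0, hpos, hmin⟩ := hi
  have hstep : ∀ s j, 0 < (P.chi ^ s) 0 j → 0 < P.chi j i → 0 < (P.chi ^ (s + 1)) 0 i := by
    intro s j h1 h2
    rw [pow_succ, Matrix.mul_apply]
    exact Finset.sum_pos' (fun l _ => mul_nonneg (hP.pow_nonneg s 0 l) (hP.nonneg l i))
      ⟨j, Finset.mem_univ j, mul_pos h1 h2⟩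
  have hpos' := hpos
  rw [pow_succ, Matrix.mul_apply] at hpos'
  obtain ⟨j, -, hj⟩ := Finset.exists_lt_of_sum_lt
    (f := fun _ : Fin k => (0 : ℝ)) (by simpa using hpos')
  have h1 : 0 < (P.chi ^ h) 0 j := pos_of_mul_pos_left hj (hP.nonneg j i)
  have h2 : 0 < P.chi j i := pos_of_mul_pos_right hj (hP.pow_nonneg h 0 j)
  refine ⟨j, ?_, hP.symm_pos _ _ h2⟩
  cases h with
  | zero =>
    by_contra hne
    have : j ≠ 0 := hne
    simp [this.symm] at h1
  | succ h =>
    refine ⟨fun hj0 => ?_, h1, fun s hs1 hs2 => ?_⟩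
    · subst hj0
      have := hmin 1 le_rfl (by omega)
      rw [pow_one] at this
      exact h2.ne' this
    · by_contra hne
      have := hstep s j (lt_of_le_of_ne (hP.pow_nonneg s 0 j) (Ne.symm hne)) h2
      exact this.ne' (hmin (s + 1) (by omega) (by omega))

/-- The supremum in `dbar` is meaningful because only finitely many shells are nonempty: each
community lies in exactly one. -/
theorem Core.le_dbar {i : Fin k} {h : ℕ} (hi : i ∈ P.shell h) : h ≤ P.dbar := by
  refine le_csSup ?_ ⟨i, hi⟩
  apply Set.Finite.bddAbove
  choose f hf using hP.exists_mem_shell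
  refine (Set.finite_range f).subset ?_
  rintro h ⟨j, hj⟩
  exact ⟨j, shell_unique (hf j) hj⟩

omit hP in
theorem start_apply {i : Fin k} {h : ℕ} (hi : i ∈ P.shell h) (m : ℕ) :
    P.start m i = if h < m then P.beta h else 0 := by
  have h1 : ∀ s, (P.shell s).indicator (fun _ => P.beta s) i = if h = s then P.beta h else 0 := by
    intro s
    by_cases hs : h = s
    · subst hs
      simp [hi]
    · have : i ∉ P.shell s := fun h' => hs (shell_unique hi h')
      simp [hs, this]
  simp [start, h1]

theorem Core.x0_apply {i : Fin k} {h : ℕ} (hi : i ∈ P.shell h) : P.x0 i = P.beta h := by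
  rw [x0, start_apply hi, if_pos (Nat.lt_succ_of_le (hP.le_dbar hi))]

theorem Core.x0_pos (i : Fin k) : 0 < P.x0 i := by
  obtain ⟨h, hi⟩ := hP.exists_mem_shell i
  rw [hP.x0_apply hi]
  exact hP.beta_pos h

theorem Core.start_mono (m : ℕ) (i : Fin k) : P.start m i ≤ P.start (m + 1) i := by
  obtain ⟨h, hi⟩ := hP.exists_mem_shell i
  have := hP.beta_pos h
  rw [start_apply hi, start_apply hi]
  split_ifs <;> first | exact le_rfl | exact this.le | omega

omit hP in
theorem start_zero : P.start 0 = 0 := by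
  ext i
  simp [start]

/-- The factor `1 / 2` in `beta` leaves a factor two of room. This slack gives both `ρ(x_0) > 0` and
the strict bound of `x_0` by every barrier. -/
theorem Core.two_mul_beta_succ_le {h : ℕ} {x : Vec k} (hx : ∀ i, 0 ≤ x i)
    (hle : ∀ j ∈ P.shell h, P.beta h ≤ x j) {i : Fin k} (hi : i ∈ P.shell (h + 1)) :
    2 * P.beta (h + 1) ≤ P.c * P.lin x i ^ P.r := by
  obtain ⟨j, hj, hij⟩ := hP.exists_pred_shell hi
  have h1 : P.chiMin * P.beta h ≤ P.lin x i := by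
    calc P.chiMin * P.beta h ≤ P.chi i j * x j :=
          mul_le_mul (chiMin_le hij) (hle j hj) (hP.beta_pos h).le (hP.nonneg i j)
      _ ≤ P.lin x i := Finset.single_le_sum (f := fun j => P.chi i j * x j)
          (fun l _ => mul_nonneg (hP.nonneg i l) (hx l)) (Finset.mem_univ j)
  have h2 := pow_le_pow_left₀ (mul_nonneg hP.chiMin_mem.1.le (hP.beta_pos h).le) h1 P.r
  have h3 := mul_le_mul_of_nonneg_left h2 hP.c_pos.le
  rw [beta]
  linarith

theorem Core.rho_x0_pos (i : Fin k) : 0 < P.rho P.x0 i := by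
  have h0 : ∀ i, 0 ≤ P.x0 i := fun i => (hP.x0_pos i).le
  obtain ⟨h, hi⟩ := hP.exists_mem_shell i
  rw [rho_apply, hP.x0_apply hi]
  cases h with
  | zero =>
    obtain rfl : i = 0 := hi
    have := mul_nonneg hP.c_pos.le (_root_.pow_nonneg (hP.lin_nonneg h0 0) P.r)
    have := hP.alpha_pos
    rw [beta]
    linarith
  | succ h =>
    have := hP.two_mul_beta_succ_le h0 (fun j hj => (hP.x0_apply hj).ge) hi
    linarith [hP.alpha_nonneg i, hP.beta_pos (h + 1)]

/-- Induction over the shells: `w_i ≥ α_i + c (∑_j χ_ij w_j)^r` passes the lower bound from one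
shell to the next. -/
theorem Core.x0_lt {w : Vec k} (hw0 : ∀ i, 0 ≤ w i) (hw : ∀ i, P.rho w i ≤ 0) (i : Fin k) :
    P.x0 i < w i := by
  have key : ∀ i, P.alpha i + P.c * P.lin w i ^ P.r ≤ w i := fun i => by
    have := hw i
    rw [rho_apply] at this
    linarith
  have hall : ∀ h, ∀ i ∈ P.shell h, P.beta h < w i := by
    intro h
    induction h with
    | zero =>
      intro i hi
      obtain rfl : i = 0 := hi
      have := mul_nonneg hP.c_pos.le (_root_.pow_nonneg (hP.lin_nonneg hw0 0) P.r)
      have := hP.alpha_pos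
      rw [beta]
      linarith [key 0]
    | succ h ih =>
      intro i hi
      have := hP.two_mul_beta_succ_le hw0 (fun j hj => (ih j hj).le) hi
      linarith [key i, hP.beta_pos (h + 1), hP.alpha_nonneg i]
  obtain ⟨h, hi⟩ := hP.exists_mem_shell i
  rw [hP.x0_apply hi]
  exact hall h i hi

end InitialPoint

end LimitData

end Bootstrap

/-! ### Concatenation of monotone curves. -/

namespace Bootstrap

namespace LimitData

section MonotoneTraces

variable {k : ℕ}

/-- `C` is the trace of a continuous componentwise non-decreasing curve from `a` to `b`. -/
def JoinsMonotonically (a b : Vec k) (C : Set (Vec k)) : Prop :=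
  ∃ ζ : ℝ → Vec k, ContinuousOn ζ (Set.Icc 0 1) ∧
    (∀ i, MonotoneOn (fun t => ζ t i) (Set.Icc 0 1)) ∧ ζ '' Set.Icc 0 1 = C ∧ ζ 0 = a ∧ ζ 1 = b

theorem JoinsMonotonically.isMonotoneTrace {a b : Vec k} {C : Set (Vec k)}
    (h : JoinsMonotonically a b C) : IsMonotoneTrace C := by
  obtain ⟨ζ, h1, h2, h3, -⟩ := h
  exact ⟨ζ, h1, h2, h3⟩

theorem joinsMonotonically_image_Icc {s t : ℝ} (hst : s ≤ t) {ζ : ℝ → Vec k}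
    (hc : ContinuousOn ζ (Set.Icc s t)) (hm : ∀ i, MonotoneOn (fun u => ζ u i) (Set.Icc s t)) :
    JoinsMonotonically (ζ s) (ζ t) (ζ '' Set.Icc s t) := by
  let τ : ℝ → ℝ := fun u => s + u * (t - s)
  have hmono : Monotone τ := fun u v huv => by
    have := mul_le_mul_of_nonneg_right huv (sub_nonneg.2 hst)
    simp only [τ]
    linarith
  have h0 : τ 0 = s := by simp [τ]
  have h1 : τ 1 = t := by simp [τ]
  have hc' : Continuous τ := by fun_prop
  have himg : τ '' Set.Icc 0 1 = Set.Icc s t := by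
    apply subset_antisymm
    · rintro _ ⟨u, hu, rfl⟩
      exact ⟨h0 ▸ hmono hu.1, h1 ▸ hmono hu.2⟩
    · have := intermediate_value_Icc (zero_le_one' ℝ) hc'.continuousOn
      rwa [h0, h1] at this
  have hmaps : Set.MapsTo τ (Set.Icc 0 1) (Set.Icc s t) := Set.mapsTo_iff_image_subset.2 himg.le
  refine ⟨ζ ∘ τ, hc.comp hc'.continuousOn hmaps, fun i u hu v hv huv => ?_, ?_, ?_, ?_⟩
  · exact hm i (hmaps hu) (hmaps hv) (hmono huv)
  · rw [Set.image_comp, himg]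
  · simp [h0]
  · simp [h1]

theorem JoinsMonotonically.trans {a b c : Vec k} {C C' : Set (Vec k)}
    (h : JoinsMonotonically a b C) (h' : JoinsMonotonically b c C') :
    JoinsMonotonically a c (C ∪ C') := by
  obtain ⟨ζ, hc, hm, rfl, rfl, hb⟩ := h
  obtain ⟨ξ, hc', hm', rfl, hb', rfl⟩ := h'
  let η : ℝ → Vec k := fun t => if t ≤ 1 then ζ t else ξ (t - 1)
  have hη1 : Set.EqOn η ζ (Set.Icc 0 1) := fun t ht => if_pos ht.2
  have hη2 : Set.EqOn η (fun t => ξ (t - 1)) (Set.Icc 1 2) := fun t ht => by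
    rcases ht.1.eq_or_lt with rfl | h
    · simp [η, hb, hb']
    · exact if_neg (not_le.2 h)
  have hmaps : Set.MapsTo (fun t : ℝ => t - 1) (Set.Icc 1 2) (Set.Icc 0 1) := fun t ht =>
    ⟨by linarith [ht.1], by linarith [ht.2]⟩
  have hun : Set.Icc (0 : ℝ) 1 ∪ Set.Icc 1 2 = Set.Icc 0 2 :=
    Set.Icc_union_Icc_eq_Icc (by norm_num) (by norm_num)
  have hcη : ContinuousOn η (Set.Icc 0 2) := by
    rw [← hun]
    refine ContinuousOn.union_of_isClosed (hc.congr hη1) ?_ isClosed_Icc isClosed_Icc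
    exact (hc'.comp (by fun_prop) hmaps).congr hη2
  have hmη : ∀ i, MonotoneOn (fun t => η t i) (Set.Icc 0 2) := fun i => by
    rw [← hun]
    refine MonotoneOn.union_right (c := 1) ?_ ?_ (isGreatest_Icc (by norm_num))
      (isLeast_Icc (by norm_num))
    · intro u hu v hv huv
      simp only [hη1 hu, hη1 hv]
      exact hm i hu hv huv
    · intro u hu v hv huv
      simp only [hη2 hu, hη2 hv]
      exact hm' i (hmaps hu) (hmaps hv) (by linarith)
  have key := joinsMonotonically_image_Icc (by norm_num) hcη hmη
  have himg : η '' Set.Icc 0 2 = ζ '' Set.Icc 0 1 ∪ ξ '' Set.Icc 0 1 := by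
    rw [← hun, Set.image_union, hη1.image_eq, hη2.image_eq]
    congr 1
    rw [← Function.comp_def ξ, Set.image_comp]
    norm_num
  rw [himg, hη1 ⟨le_rfl, zero_le_one⟩, hη2 ⟨by norm_num, le_rfl⟩] at key
  norm_num at key
  exact key

theorem joinsMonotonically_segment {a b : Vec k} (hab : ∀ i, a i ≤ b i) :
    JoinsMonotonically a b (segment ℝ a b) := by
  refine ⟨fun t => a + t • (b - a), by fun_prop, fun i u _ v _ huv => ?_,
    (segment_eq_image' ℝ a b).symm, by simp, by simp⟩
  have := mul_le_mul_of_nonneg_right huv (sub_nonneg.2 (hab i))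
  simp only [PiLp.add_apply, PiLp.smul_apply, PiLp.sub_apply, smul_eq_mul]
  linarith

theorem joinsMonotonically_polygon {f : ℕ → Vec k} (hf : ∀ m i, f m i ≤ f (m + 1) i) (d : ℕ) :
    JoinsMonotonically (f 0) (f (d + 1)) (⋃ h ∈ Set.Iic d, segment ℝ (f h) (f (h + 1))) := by
  induction d with
  | zero =>
    have : Set.Iic 0 = ({0} : Set ℕ) := by ext; simp
    simpa [this] using joinsMonotonically_segment (hf 0)
  | succ d ih =>
    have := ih.trans (joinsMonotonically_segment (hf (d + 1)))
    have h2 : Set.Iic (d + 1) = insert (d + 1) (Set.Iic d) := by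
      ext m
      simp only [Set.mem_Iic, Set.mem_insert_iff]
      omega
    rwa [h2, Set.biUnion_insert, Set.union_comm]

theorem joinsMonotonically_atTop {y₀ : ℝ} {x : ℝ → Vec k} {p : Vec k}
    (hc : ContinuousOn x (Set.Ici y₀)) (hm : ∀ i, MonotoneOn (fun y => x y i) (Set.Ici y₀))
    (hp : Tendsto x atTop (𝓝 p)) :
    JoinsMonotonically (x y₀) p (x '' Set.Ici y₀ ∪ {p}) := by
  -- An increasing map of `[0, 1)` onto `[y₀, ∞)`; the limit `p` is inserted at time `1`.
  let τ : ℝ → ℝ := fun t => y₀ - 1 + (1 - t)⁻¹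
  let ζ : ℝ → Vec k := fun t => if t < 1 then x (τ t) else p
  have hτ0 : τ 0 = y₀ := by simp [τ]
  have hζ : Set.EqOn ζ (x ∘ τ) (Set.Ico 0 1) := fun t ht => if_pos ht.2
  have hζ1 : ζ 1 = p := if_neg (lt_irrefl _)
  have hτmono : MonotoneOn τ (Set.Ico 0 1) := fun u hu v hv huv => by
    have h1 : 0 < 1 - v := by linarith [hv.2]
    have := inv_anti₀ h1 (by linarith : 1 - v ≤ 1 - u)
    simp only [τ]
    linarith
  have hmaps : Set.MapsTo τ (Set.Ico 0 1) (Set.Ici y₀) := fun t ht => by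
    rw [← hτ0]
    exact hτmono ⟨le_rfl, one_pos⟩ ht ht.1
  have hsurj : τ '' Set.Ico 0 1 = Set.Ici y₀ := by
    refine subset_antisymm (Set.mapsTo_iff_image_subset.1 hmaps) fun y hy => ?_
    have hy' : 0 < y - y₀ + 1 := by linarith [Set.mem_Ici.1 hy]
    refine ⟨1 - (y - y₀ + 1)⁻¹, ⟨?_, ?_⟩, ?_⟩
    · have := inv_le_one_of_one_le₀ (by linarith [Set.mem_Ici.1 hy] : 1 ≤ y - y₀ + 1)
      linarith
    · have := inv_pos.2 hy'
      linarith
    · simp only [τ, sub_sub_cancel, inv_inv]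
      ring
  have hτc : ContinuousOn τ (Set.Ico 0 1) := by
    refine continuousOn_const.add (ContinuousOn.inv₀ (by fun_prop) fun t ht => ?_)
    exact (sub_pos.2 ht.2).ne'
  have hτtop : Tendsto τ (𝓝[Set.Ico 0 1] 1) atTop := by
    refine tendsto_atTop_add_const_left _ _ (tendsto_inv_nhdsGT_zero.comp ?_)
    refine tendsto_nhdsWithin_iff.2 ⟨?_, ?_⟩
    · have : Continuous fun t : ℝ => 1 - t := by fun_prop
      have := this.tendsto 1
      rw [sub_self] at this
      exact this.mono_left nhdsWithin_le_nhds
    · filter_upwards [self_mem_nhdsWithin] with t ht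
      exact sub_pos.2 ht.2
  have hins : insert 1 (Set.Ico (0 : ℝ) 1) = Set.Icc 0 1 :=
    Set.Ico_insert_right zero_le_one
  have hle : ∀ i, ∀ y ∈ Set.Ici y₀, x y i ≤ p i := fun i y hy => by
    have h1 : Tendsto (fun y => x y i) atTop (𝓝 (p i)) :=
      ((EuclideanSpace.proj (𝕜 := ℝ) i).continuous.tendsto p).comp hp
    refine ge_of_tendsto h1 ?_
    filter_upwards [eventually_ge_atTop y] with z hz
    exact hm i hy (le_trans hy hz) hz
  refine ⟨ζ, ?_, ?_, ?_, ?_, hζ1⟩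
  · rw [← hins]
    intro t ht
    rcases eq_or_ne t 1 with rfl | hne
    · rw [continuousWithinAt_insert_self, ContinuousWithinAt, hζ1]
      refine (hp.comp hτtop).congr' ?_
      filter_upwards [self_mem_nhdsWithin] with t ht
      exact (hζ ht).symm
    · have ht' : t ∈ Set.Ico (0 : ℝ) 1 := ht.resolve_left hne
      rw [continuousWithinAt_insert]
      exact ((hc.comp hτc hmaps).congr hζ) t ht'
  · intro i u hu v hv huv
    simp only
    rcases hv.2.eq_or_lt with rfl | hv1
    · rw [hζ1]
      rcases hu.2.eq_or_lt with rfl | hu1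
      · rw [hζ1]
      · rw [hζ ⟨hu.1, hu1⟩]
        exact hle i _ (hmaps ⟨hu.1, hu1⟩)
    · have hu' : u ∈ Set.Ico (0 : ℝ) 1 := ⟨hu.1, huv.trans_lt hv1⟩
      have hv' : v ∈ Set.Ico (0 : ℝ) 1 := ⟨hv.1, hv1⟩
      rw [hζ hu', hζ hv']
      exact hm i (hmaps hu') (hmaps hv') (hτmono hu' hv' huv)
  · rw [← hins, Set.image_insert_eq, hζ1, hζ.image_eq, Set.image_comp, hsurj,
      Set.union_singleton]
  · rw [hζ ⟨le_rfl, one_pos⟩, Function.comp_apply, hτ0]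

end MonotoneTraces

end LimitData

end Bootstrap

/-! ### Global integral curves and preservation of positivity. -/

namespace Bootstrap

section ODE

/-- A bounded Lipschitz vector field has global integral curves. -/
theorem exists_global_integralCurve {E : Type*} [NormedAddCommGroup E] [NormedSpace ℝ E]
    [CompleteSpace E] {F : E → E} {K : NNReal} (hF : LipschitzWith K F) {L : NNReal}
    (hL : ∀ x, ‖F x‖ ≤ L) (t₀ : ℝ) (x₀ : E) :
    ∃ X : ℝ → E, X t₀ = x₀ ∧ ∀ t, HasDerivAt X (F (X t)) t := by
  have hex : ∀ n : ℕ, ∃ α : ℝ → E, α t₀ = x₀ ∧ ∀ t ∈ Set.Icc (t₀ - (n + 1)) (t₀ + (n + 1)),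
      HasDerivWithinAt α (F (α t)) (Set.Icc (t₀ - (n + 1)) (t₀ + (n + 1))) t := by
    intro n
    have hn : (0 : ℝ) < n + 1 := by positivity
    -- The radius `L (n + 1)` is speed bound times half-length, so one Picard-Lindelöf application
    -- covers the whole interval.
    have hpl : IsPicardLindelof (fun _ : ℝ => F) (tmin := t₀ - (n + 1)) (tmax := t₀ + (n + 1))
        ⟨t₀, by constructor <;> linarith⟩ x₀ (L * (n + 1)) 0 L K := by
      refine ⟨fun _ _ => hF.lipschitzOnWith, fun _ _ => continuousOn_const,
        fun _ _ x _ => hL x, ?_⟩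
      simp
    exact hpl.exists_eq_forall_mem_Icc_hasDerivWithinAt₀
  choose α hα0 hα using hex
  have hd : ∀ n : ℕ, ∀ t ∈ Set.Ioo (t₀ - (n + 1)) (t₀ + (n + 1)),
      HasDerivAt (α n) (F (α n t)) t := fun n t ht =>
    (hα n t (Set.Ioo_subset_Icc_self ht)).hasDerivAt (Icc_mem_nhds ht.1 ht.2)
  have hagree : ∀ m n : ℕ, m ≤ n →
      Set.EqOn (α m) (α n) (Set.Ioo (t₀ - (m + 1)) (t₀ + (m + 1))) := by
    intro m n hmn
    have hm : (0 : ℝ) < m + 1 := by positivity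
    have hmn' : (m : ℝ) ≤ n := by exact_mod_cast hmn
    refine ODE_solution_unique_of_mem_Ioo (v := fun _ => F) (s := fun _ => Set.univ) (K := K)
      (t₀ := t₀) (fun _ _ => hF.lipschitzOnWith) ⟨by linarith, by linarith⟩
      (fun t ht => ⟨hd m t ht, trivial⟩)
      (fun t ht => ⟨hd n t ⟨by linarith [ht.1], by linarith [ht.2]⟩, trivial⟩)
      (by rw [hα0, hα0])
  have hmem : ∀ t, t ∈ Set.Ioo (t₀ - ((⌈|t - t₀|⌉₊ : ℝ) + 1)) (t₀ + ((⌈|t - t₀|⌉₊ : ℝ) + 1)) := by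
    intro t
    have h1 := Nat.le_ceil |t - t₀|
    have h2 := abs_le.1 h1
    constructor <;> linarith [h2.1, h2.2]
  let X : ℝ → E := fun t => α ⌈|t - t₀|⌉₊ t
  have hX : ∀ n : ℕ, Set.EqOn X (α n) (Set.Ioo (t₀ - (n + 1)) (t₀ + (n + 1))) := by
    intro n t ht
    rcases le_total n ⌈|t - t₀|⌉₊ with h | h
    · exact (hagree _ _ h ht).symm
    · exact hagree _ _ h (hmem t)
  refine ⟨X, by simp [X, hα0], fun t => ?_⟩
  have h1 : X =ᶠ[𝓝 t] α ⌈|t - t₀|⌉₊ := by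
    filter_upwards [Ioo_mem_nhds (hmem t).1 (hmem t).2] with s hs using hX _ hs
  exact (hd _ t (hmem t)).congr_of_eventuallyEq h1

/-- A vector function that starts positive stays positive if `u' ≥ -u` as long as `u ≥ 0`. -/
theorem forall_pos_of_neg_le_deriv {k : ℕ} {u u' : ℝ → Fin k → ℝ} {a b : ℝ}
    (h0 : ∀ i, 0 < u a i)
    (hd : ∀ t ∈ Set.Icc a b, ∀ i, HasDerivWithinAt (fun t => u t i) (u' t i) (Set.Ici a) t)
    (hle : ∀ t ∈ Set.Icc a b, (∀ s ∈ Set.Icc a t, ∀ i, 0 ≤ u s i) → ∀ i, -u t i ≤ u' t i) :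
    ∀ t ∈ Set.Icc a b, ∀ i, 0 < u t i := by
  by_contra! hcon
  obtain ⟨t₁, ht₁, i₁, hi₁⟩ := hcon
  have hc : ∀ i, ContinuousOn (fun t => u t i) (Set.Icc a b) := fun i t ht =>
    (hd t ht i).continuousWithinAt.mono Set.Icc_subset_Ici_self
  let B : Set ℝ := ⋃ i, Set.Icc a b ∩ (fun t => u t i) ⁻¹' Set.Iic 0
  have hB : IsCompact B := isCompact_iUnion fun i =>
    isCompact_Icc.of_isClosed_subset
      ((hc i).preimage_isClosed_of_isClosed isClosed_Icc isClosed_Iic) Set.inter_subset_left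
  -- The first time at which some component is nonpositive. Until then `exp t * u t i` is
  -- nondecreasing, so it cannot have dropped to `0`.
  obtain ⟨τ, hτB, hτ⟩ := hB.exists_isLeast ⟨t₁, Set.mem_iUnion.2 ⟨i₁, ht₁, hi₁⟩⟩
  obtain ⟨i, hτI, hi⟩ := Set.mem_iUnion.1 hτB
  have hlt : ∀ s ∈ Set.Ico a τ, ∀ j, 0 < u s j := fun s hs j => by
    by_contra hcon
    have := hτ (Set.mem_iUnion.2 ⟨j, ⟨hs.1, hs.2.le.trans hτI.2⟩, not_lt.1 hcon⟩)
    exact absurd hs.2 (not_lt.2 this)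
  have hsub : ∀ s ∈ Set.Icc a τ, s ∈ Set.Icc a b := fun s hs => ⟨hs.1, hs.2.trans hτI.2⟩
  have hmono : MonotoneOn (fun t => Real.exp t * u t i) (Set.Icc a τ) := by
    have hder : ∀ s ∈ interior (Set.Icc a τ), HasDerivAt (fun t => Real.exp t * u t i)
        (Real.exp s * u s i + Real.exp s * u' s i) s := by
      intro s hs
      rw [interior_Icc] at hs
      exact (Real.hasDerivAt_exp s).mul
        ((hd s (hsub s (Set.Ioo_subset_Icc_self hs)) i).hasDerivAt (Ici_mem_nhds hs.1))
    refine monotoneOn_of_deriv_nonneg (convex_Icc a τ)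
      (Real.continuous_exp.continuousOn.mul ((hc i).mono hsub))
      (fun s hs => (hder s hs).differentiableAt.differentiableWithinAt) fun s hs => ?_
    rw [(hder s hs).deriv, ← mul_add]
    rw [interior_Icc] at hs
    have := hle s (hsub s (Set.Ioo_subset_Icc_self hs))
      (fun r hr j => (hlt r ⟨hr.1, hr.2.trans_lt hs.2⟩ j).le) i
    exact mul_nonneg (Real.exp_pos s).le (by linarith)
  have h1 := hmono (Set.left_mem_Icc.2 hτI.1) (Set.right_mem_Icc.2 hτI.1) hτI.1
  have h2 := mul_pos (Real.exp_pos a) (h0 i)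
  have h3 : Real.exp τ * u τ i ≤ 0 := mul_nonpos_of_nonneg_of_nonpos (Real.exp_pos τ).le hi
  simp only at h1
  linarith

end ODE

/-! ### Solutions of the Cauchy problem: monotonicity, barriers and continuation. -/

namespace LimitData

variable {k : ℕ} [NeZero k] {P : LimitData k}

section Solutions

variable {y₀ : ℝ} {T : EReal} {x : ℝ → Vec k}

theorem IsSolutionOn.hasDerivWithinAt_apply (hx : P.IsSolutionOn y₀ T x) {y : ℝ} (hy : y₀ ≤ y)
    (hyT : (y : EReal) < T) (i : Fin k) :
    HasDerivWithinAt (fun y => x y i) (P.rho (x y) i) (Set.Ici y₀) y :=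
  ((EuclideanSpace.proj i : Vec k →L[ℝ] ℝ).hasFDerivAt.comp_hasDerivWithinAt y
    (hx.2 y hy hyT).2 :)

theorem IsSolutionOn.hasDerivWithinAt_rho (hx : P.IsSolutionOn y₀ T x) {y : ℝ} (hy : y₀ ≤ y)
    (hyT : (y : EReal) < T) (i : Fin k) :
    HasDerivWithinAt (fun y => P.rho (x y) i) (P.drho (x y) (P.rho (x y)) i) (Set.Ici y₀) y := by
  rw [← fderiv_rho_apply]
  have h := P.hasFDerivAt_rho_apply (x y) i
  rw [h.fderiv]
  exact h.comp_hasDerivWithinAt y (hx.2 y hy hyT).2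

theorem IsSolutionOn.continuousOn (hx : P.IsSolutionOn y₀ T x) {s : Set ℝ}
    (hs : ∀ y ∈ s, y₀ ≤ y ∧ (y : EReal) < T) : ContinuousOn x s := fun y hy =>
  ((hx.2 y (hs y hy).1 (hs y hy).2).2.continuousWithinAt).mono fun z hz => (hs z hz).1

theorem IsSolutionOn.monotoneOn_Icc (hx : P.IsSolutionOn y₀ T x) {b : ℝ} (hb : (b : EReal) < T)
    (hρ : ∀ y ∈ Set.Icc y₀ b, ∀ i, 0 ≤ P.rho (x y) i) (i : Fin k) :
    MonotoneOn (fun y => x y i) (Set.Icc y₀ b) := by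
  have hs : ∀ y ∈ Set.Icc y₀ b, y₀ ≤ y ∧ (y : EReal) < T := fun y hy =>
    ⟨hy.1, (EReal.coe_le_coe_iff.2 hy.2).trans_lt hb⟩
  have hder : ∀ s ∈ interior (Set.Icc y₀ b), HasDerivAt (fun y => x y i) (P.rho (x s) i) s := by
    intro s hs'
    rw [interior_Icc] at hs'
    have := hs s (Set.Ioo_subset_Icc_self hs')
    exact (hx.hasDerivWithinAt_apply this.1 this.2 i).hasDerivAt (Ici_mem_nhds hs'.1)
  refine monotoneOn_of_deriv_nonneg (convex_Icc y₀ b) ?_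
    (fun s hs => (hder s hs).differentiableAt.differentiableWithinAt) fun s hs => ?_
  · have := hx.continuousOn hs
    fun_prop
  · rw [(hder s hs).deriv]
    exact hρ s (interior_subset hs) i

variable (hP : P.Core)
include hP

/-- Along the solution `ρ` satisfies `ρ' = J ρ`, where `J + 1` is nonnegative because `x ≥ 0`; hence
`ρ' ≥ -ρ` as long as `ρ ≥ 0`. -/
theorem Core.rho_pos (hx : P.IsSolutionOn y₀ T x) {y : ℝ} (hy : y₀ ≤ y) (hyT : (y : EReal) < T)
    (i : Fin k) : 0 < P.rho (x y) i := by
  have hT : ∀ t ∈ Set.Icc y₀ y, (t : EReal) < T := fun t ht =>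
    (EReal.coe_le_coe_iff.2 ht.2).trans_lt hyT
  refine forall_pos_of_neg_le_deriv (u := fun y i => P.rho (x y) i)
    (u' := fun y i => P.drho (x y) (P.rho (x y)) i) (a := y₀) (b := y) ?_
    (fun t ht i => hx.hasDerivWithinAt_rho ht.1 (hT t ht) i) ?_ y ⟨hy, le_rfl⟩ i
  · rw [hx.1]
    exact hP.rho_x0_pos
  · intro t ht hpos i
    have hmono := hx.monotoneOn_Icc (hT t ht) hpos
    have hx0 : ∀ i, 0 ≤ x t i := fun i => by
      have := hmono i (Set.left_mem_Icc.2 ht.1) (Set.right_mem_Icc.2 ht.1) ht.1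
      simp only [hx.1] at this
      exact (hP.x0_pos i).le.trans this
    have h1 := hP.lin_nonneg hx0 i
    have h2 := hP.lin_nonneg (hpos t ⟨ht.1, le_rfl⟩) i
    have h3 := hP.c_pos
    rw [drho]
    have : 0 ≤ P.c * (P.r * P.lin (x t) i ^ (P.r - 1)) * P.lin (P.rho (x t)) i := by positivity
    linarith

theorem Core.solution_mono (hx : P.IsSolutionOn y₀ T x) {y z : ℝ} (hy : y₀ ≤ y) (hyz : y ≤ z)
    (hzT : (z : EReal) < T) (i : Fin k) : x y i ≤ x z i :=
  hx.monotoneOn_Icc hzT (fun _ ht i => (hP.rho_pos hx ht.1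
    ((EReal.coe_le_coe_iff.2 ht.2).trans_lt hzT) i).le) i ⟨hy, hyz⟩ ⟨hy.trans hyz, le_rfl⟩ hyz

theorem Core.x0_le_solution (hx : P.IsSolutionOn y₀ T x) {y : ℝ} (hy : y₀ ≤ y)
    (hyT : (y : EReal) < T) (i : Fin k) : P.x0 i ≤ x y i := by
  have := hP.solution_mono hx le_rfl hy hyT i
  rwa [hx.1] at this

theorem Core.solution_pos (hx : P.IsSolutionOn y₀ T x) {y : ℝ} (hy : y₀ ≤ y)
    (hyT : (y : EReal) < T) (i : Fin k) : 0 < x y i :=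
  (hP.x0_pos i).trans_le (hP.x0_le_solution hx hy hyT i)

/-- While `x ≤ w`, quasi-monotonicity gives `ρ(x) + x ≤ ρ(w) + w ≤ w`, that is `(w - x)' ≥ -(w -
x)`. -/
theorem Core.solution_lt (hx : P.IsSolutionOn y₀ T x) {w : Vec k} (hw0 : ∀ i, 0 ≤ w i)
    (hw : ∀ i, P.rho w i ≤ 0) {y : ℝ} (hy : y₀ ≤ y) (hyT : (y : EReal) < T) (i : Fin k) :
    x y i < w i := by
  have hT : ∀ t ∈ Set.Icc y₀ y, (t : EReal) < T := fun t ht =>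
    (EReal.coe_le_coe_iff.2 ht.2).trans_lt hyT
  refine sub_pos.1 (forall_pos_of_neg_le_deriv (u := fun y i => w i - x y i)
    (u' := fun y i => -P.rho (x y) i) (a := y₀) (b := y) ?_
    (fun t ht i => (hx.hasDerivWithinAt_apply ht.1 (hT t ht) i).const_sub (w i)) ?_ y
    ⟨hy, le_rfl⟩ i)
  · rw [hx.1]
    exact fun i => sub_pos.2 (hP.x0_lt hw0 hw i)
  · intro t ht hpos i
    have := hP.rho_le_of_le (fun i => (hP.solution_pos hx ht.1 (hT t ht) i).le)
      (fun j => sub_nonneg.1 (hpos t ⟨ht.1, le_rfl⟩ j)) i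
    linarith [hw i]

theorem Core.diam_D_pos : 0 < Metric.diam P.D := by
  have h1 : ∀ᶠ t in 𝓝[>] (0 : ℝ), ∀ i, P.lin (t • P.x0) i < P.top := by
    refine eventually_all.2 fun i => ?_
    have hc : Continuous fun t : ℝ => P.lin (t • P.x0) i := by
      have := P.continuous_lin i
      fun_prop
    have := hc.tendsto 0
    simp only [lin_smul, zero_mul] at this ⊢
    exact (this.eventually (gt_mem_nhds hP.top_pos)).filter_mono nhdsWithin_le_nhds
  obtain ⟨t, ht, ht0⟩ := (h1.and self_mem_nhdsWithin).exists
  have hpos : ∀ i, 0 < (t • P.x0) i := fun i => mul_pos ht0 (hP.x0_pos i)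
  have hD : t • P.x0 ∈ P.D := hP.mem_D.2 ⟨fun i => (hpos i).le, fun i => (ht i).le⟩
  refine lt_of_lt_of_le (dist_pos.2 ?_)
    (Metric.dist_le_diam_of_mem hP.isCompact_D.isBounded hD hP.zero_mem_D)
  intro h
  have := hpos 0
  rw [h] at this
  simp at this

/-- As `0 < x_0 ≤ w`, the point `w` is strictly closer to `x_0` than to `0`, which also lies in `𝓓`.
So the ball never constrains a solution inside `𝓓`. -/
theorem Core.dist_x0_lt {w : Vec k} (hw : w ∈ P.D) (h : ∀ i, P.x0 i ≤ w i) :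
    dist w P.x0 < Metric.diam P.D := by
  refine lt_of_lt_of_le ?_
    (Metric.dist_le_diam_of_mem hP.isCompact_D.isBounded hw hP.zero_mem_D)
  rw [EuclideanSpace.dist_eq, EuclideanSpace.dist_eq]
  refine Real.sqrt_lt_sqrt (Finset.sum_nonneg fun i _ => sq_nonneg _) ?_
  refine Finset.sum_lt_sum_of_nonempty ⟨0, Finset.mem_univ _⟩ fun i _ => ?_
  rw [Real.dist_eq, Real.dist_eq, sq_abs, sq_abs, PiLp.zero_apply, sub_zero]
  exact pow_lt_pow_left₀ (by linarith [hP.x0_pos i]) (sub_nonneg.2 (h i)) two_ne_zero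

/-- A global curve that solves the Cauchy problem as long as it stays in the ball and with
which all solutions coincide. -/
theorem Core.exists_cutoff_solution (y₀ : ℝ) :
    ∃ X : ℝ → Vec k, X y₀ = P.x0 ∧ Continuous X ∧
      (∀ y, X y ∈ Metric.closedBall P.x0 (Metric.diam P.D) → HasDerivAt X (P.rho (X y)) y) ∧
      ∀ (T : EReal) (x : ℝ → Vec k), P.IsSolutionOn y₀ T x →
        ∀ y, y₀ ≤ y → (y : EReal) < T → x y = X y := by
  -- Multiplying by a bump function equal to `1` on the ball makes the field bounded and globally
  -- Lipschitz without changing it there.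
  let b : ContDiffBump P.x0 := ⟨Metric.diam P.D, Metric.diam P.D + 1, hP.diam_D_pos, by linarith⟩
  let F : Vec k → Vec k := fun x => b x • P.rho x
  have hb : ∀ z ∈ Metric.closedBall P.x0 (Metric.diam P.D), F z = P.rho z := fun z hz => by
    simp only [F, b.one_of_mem_closedBall hz, one_smul]
  have hcd : ContDiff ℝ 1 F := b.contDiff.smul P.contDiff_rho
  have hsupp : HasCompactSupport F := b.hasCompactSupport.smul_right
  obtain ⟨K, hK⟩ := hcd.lipschitzWith_of_hasCompactSupport hsupp one_ne_zero
  obtain ⟨L, hL⟩ := hsupp.exists_bound_of_continuous hcd.continuous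
  obtain ⟨X, hX0, hX⟩ := exists_global_integralCurve hK (L := L.toNNReal)
    (fun z => (hL z).trans (Real.le_coe_toNNReal L)) y₀ P.x0
  have hXc : Continuous X := continuous_iff_continuousAt.2 fun y => (hX y).continuousAt
  refine ⟨X, hX0, hXc, fun y hy => hb _ hy ▸ hX y, fun T x hx y hy hyT => ?_⟩
  have hs : ∀ t ∈ Set.Icc y₀ y, y₀ ≤ t ∧ (t : EReal) < T := fun t ht =>
    ⟨ht.1, (EReal.coe_le_coe_iff.2 ht.2).trans_lt hyT⟩
  refine ODE_solution_unique (v := fun _ => F) (K := K) (fun _ => hK) (hx.continuousOn hs)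
    (fun t ht => ?_) hXc.continuousOn (fun t _ => (hX t).hasDerivWithinAt) (hx.1.trans hX0.symm)
    ⟨hy, le_rfl⟩
  have h1 := hs t (Set.Ico_subset_Icc_self ht)
  obtain ⟨h2, h3⟩ := hx.2 t h1.1 h1.2
  simp only [hb _ h2]
  exact h3.mono (Set.Ici_subset_Ici.2 h1.1)

theorem Core.exists_isMaximalSolution (y₀ : ℝ) :
    ∃ (yplus : EReal) (x : ℝ → Vec k), P.IsMaximalSolution y₀ yplus x := by
  obtain ⟨X, hX0, hXc, hX, huniq⟩ := hP.exists_cutoff_solution y₀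
  let A : Set EReal := {T | ∀ y : ℝ, y₀ ≤ y → (y : EReal) < T →
    X y ∈ Metric.closedBall P.x0 (Metric.diam P.D)}
  refine ⟨sSup A, X, ?_, ⟨hX0, fun y hy hyA => ?_⟩, fun T x hx => ?_⟩
  · have h1 : ∀ᶠ y in 𝓝 y₀, X y ∈ Metric.closedBall P.x0 (Metric.diam P.D) := by
      refine hXc.continuousAt.eventually_mem ?_
      rw [hX0]
      exact Metric.closedBall_mem_nhds _ hP.diam_D_pos
    obtain ⟨ε, hε, h⟩ := Metric.eventually_nhds_iff_ball.1 h1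
    have hA : ((y₀ + ε : ℝ) : EReal) ∈ A := fun y hy hyε => h y (by
      rw [EReal.coe_lt_coe_iff] at hyε
      rw [Real.ball_eq_Ioo]
      constructor <;> linarith)
    exact lt_of_lt_of_le (EReal.coe_lt_coe_iff.2 (by linarith)) (le_sSup hA)
  · obtain ⟨T, hT, hyT⟩ := lt_sSup_iff.1 hyA
    have := hT y hy hyT
    exact ⟨this, (hX y this).hasDerivWithinAt⟩
  · refine le_sSup fun y hy hyT => ?_
    rw [← huniq T x hx y hy hyT]
    exact (hx.2 y hy hyT).1

/-- A maximal solution that stays in `𝓓` exists for all times. -/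
theorem Core.yplus_eq_top {yplus : EReal} (hx : P.IsMaximalSolution y₀ yplus x)
    (hD : ∀ y : ℝ, y₀ ≤ y → (y : EReal) < yplus → x y ∈ P.D) : yplus = ⊤ := by
  obtain ⟨hlt, hsol, hmax⟩ := hx
  obtain ⟨X, hX0, hXc, hX, huniq⟩ := hP.exists_cutoff_solution y₀
  by_contra hne
  obtain ⟨b, rfl⟩ : ∃ b : ℝ, (b : EReal) = yplus :=
    ⟨yplus.toReal, EReal.coe_toReal hne (ne_bot_of_gt hlt)⟩
  rw [EReal.coe_lt_coe_iff] at hlt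
  have hclosed : IsClosed (P.D ∩ {w | ∀ i, P.x0 i ≤ w i}) := by
    refine hP.isClosed_D.inter ?_
    rw [Set.ofPred_forall]
    exact isClosed_iInter fun i => isClosed_le continuous_const (by fun_prop)
  have hmaps : Set.MapsTo X (Set.Ico y₀ b) (P.D ∩ {w | ∀ i, P.x0 i ≤ w i}) := fun y hy => by
    have hyb := EReal.coe_lt_coe_iff.2 hy.2
    rw [← huniq _ x hsol y hy.1 hyb]
    exact ⟨hD y hy.1 hyb, hP.x0_le_solution hsol hy.1 hyb⟩
  have hXb := hmaps.closure hXc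
  rw [closure_Ico hlt.ne, hclosed.closure_eq] at hXb
  obtain ⟨h1, h2⟩ := hXb ⟨hlt.le, le_rfl⟩
  -- The endpoint lies in the open ball, so the curve continues past `b`, against maximality.
  have h3 : ∀ᶠ y in 𝓝 b, X y ∈ Metric.closedBall P.x0 (Metric.diam P.D) :=
    hXc.continuousAt.eventually_mem
      (mem_of_superset (Metric.isOpen_ball.mem_nhds (hP.dist_x0_lt h1 h2))
        Metric.ball_subset_closedBall)
  obtain ⟨ε, hε, h⟩ := Metric.eventually_nhds_iff_ball.1 h3
  have hsolX : P.IsSolutionOn y₀ ((b + ε : ℝ) : EReal) X := by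
    refine ⟨hX0, fun y hy hyε => ?_⟩
    rw [EReal.coe_lt_coe_iff] at hyε
    have hmem : X y ∈ Metric.closedBall P.x0 (Metric.diam P.D) := by
      rcases lt_or_ge y b with hyb | hyb
      · have hyb' := EReal.coe_lt_coe_iff.2 hyb
        rw [← huniq _ x hsol y hy hyb']
        exact (hsol.2 y hy hyb').1
      · refine h y ?_
        rw [Real.ball_eq_Ioo]
        constructor <;> linarith
    exact ⟨hmem, (hX y hmem).hasDerivWithinAt⟩
  have := EReal.coe_le_coe_iff.1 (hmax _ _ hsolX)
  linarith

end Solutions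

end LimitData

end Bootstrap

namespace Bootstrap

/-! ### Limits and exit points of the solution. -/

namespace LimitData

section ExitPoints

variable {k : ℕ}

theorem isExitPoint_top_iff {y₀ : ℝ} {x : ℝ → Vec k} {p : Vec k} :
    IsExitPoint y₀ ⊤ x p ↔ Tendsto x atTop (𝓝 p) := by
  have h1 : comap (fun y : ℝ => (y : EReal)) (𝓝 ⊤) = atTop := by
    refine (EReal.nhds_top_basis.comap _).ext atTop_basis_Ioi ?_ ?_ <;>
    · intro a _
      exact ⟨a, trivial, fun y hy => by simpa using hy⟩
  have h2 : (fun y : ℝ => (y : EReal)) ⁻¹' Set.Ioo (y₀ : EReal) ⊤ = Set.Ioi y₀ := by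
    ext y
    simp
  rw [IsExitPoint, nhdsWithin, comap_inf, comap_principal, h1, h2,
    inf_of_le_left (le_principal_iff.2 (Ioi_mem_atTop y₀))]

theorem isExitPoint_coe_of_continuousWithinAt {y₀ b : ℝ} {x : ℝ → Vec k}
    (h : ContinuousWithinAt x (Set.Ioo y₀ b) b) : IsExitPoint y₀ b x (x b) := by
  have h2 : (fun y : ℝ => (y : EReal)) ⁻¹' Set.Ioo (y₀ : EReal) b = Set.Ioo y₀ b := by
    ext y
    simp
  rw [IsExitPoint, nhdsWithin, comap_inf, comap_principal, h2, ← EReal.isEmbedding_coe.nhds_eq_comap]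
  exact h

/-- A function with a limit cannot have a derivative that tends to a positive number. -/
theorem limit_deriv_nonpos {f f' : ℝ → ℝ} {a l m : ℝ} (hd : ∀ y, a < y → HasDerivAt f (f' y) y)
    (hl : Tendsto f atTop (𝓝 l)) (hm : Tendsto f' atTop (𝓝 m)) : m ≤ 0 := by
  by_contra hcon
  have hm0 : 0 < m := not_le.1 hcon
  obtain ⟨Y, hY⟩ := eventually_atTop.1 (hm.eventually (lt_mem_nhds (half_lt_self hm0)))
  let Z := max Y (a + 1)
  have hZ : ∀ y, Z ≤ y → a < y := fun y hy => by
    have := le_max_right Y (a + 1)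
    linarith
  have hmono : MonotoneOn (fun y => f y - m / 2 * y) (Set.Ici Z) := by
    have hder : ∀ y ∈ Set.Ici Z, HasDerivAt (fun y => f y - m / 2 * y) (f' y - m / 2) y := by
      intro y hy
      have := (hd y (hZ y hy)).sub ((hasDerivAt_id y).const_mul (m / 2))
      rwa [mul_one] at this
    refine monotoneOn_of_deriv_nonneg (convex_Ici Z)
      (fun y hy => (hder y hy).continuousAt.continuousWithinAt)
      (fun y hy => (hder y (interior_subset hy)).differentiableAt.differentiableWithinAt)
      fun y hy => ?_
    have hy' := interior_subset hy
    rw [(hder y hy').deriv]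
    linarith [hY y ((le_max_left _ _).trans hy')]
  have htop : Tendsto f atTop atTop := by
    have h1 : Tendsto (fun y => f Z - m / 2 * Z + m / 2 * y) atTop atTop :=
      tendsto_atTop_add_const_left _ _ (tendsto_id.const_mul_atTop (half_pos hm0))
    refine tendsto_atTop_mono' _ ?_ h1
    filter_upwards [eventually_ge_atTop Z] with y hy
    have := hmono (Set.mem_Ici.2 le_rfl) hy hy
    simp only at this
    linarith
  exact not_tendsto_nhds_of_tendsto_atTop htop l hl

end ExitPoints

variable {k : ℕ} [NeZero k] {P : LimitData k}

theorem JoinsMonotonically.exists_isLeast_valuesOn {a b : Vec k} {A : Set (Vec k)}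
    (h : JoinsMonotonically a b A) : ∃ m, IsLeast (P.valuesOn A) m := by
  obtain ⟨ζ, hc, -, rfl, -, -⟩ := h
  have hcomp : IsCompact (ζ '' Set.Icc 0 1) := isCompact_Icc.image_of_continuousOn hc
  have heq : P.valuesOn (ζ '' Set.Icc 0 1) = ⋃ i, (fun z => P.rho z i) '' (ζ '' Set.Icc 0 1) := by
    ext t
    simp only [valuesOn, Set.mem_ofPred_eq, Set.mem_iUnion, Set.mem_image (fun z => P.rho z _)]
    exact ⟨fun ⟨z, hz, i, hi⟩ => ⟨i, z, hz, hi⟩, fun ⟨i, z, hz, hi⟩ => ⟨z, hz, i, hi⟩⟩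
  rw [heq]
  apply IsCompact.exists_isLeast
  · exact isCompact_iUnion fun i => hcomp.image (P.continuous_rho_apply i)
  · exact ⟨_, Set.mem_iUnion.2 ⟨0, _, ⟨0, ⟨le_rfl, zero_le_one⟩, rfl⟩, rfl⟩⟩

/-! ### The conditions in terms of the Cauchy problem. -/

section Main

variable (hP : P.Core) {y₀ : ℝ} {T yplus : EReal} {x : ℝ → Vec k}
include hP

theorem Core.isGoodCurve {C : Set (Vec k)} {q : Vec k} (h : JoinsMonotonically 0 q C)
    (hq : q ∈ P.Dtilde) : P.IsGoodCurve C := by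
  refine ⟨h.isMonotoneTrace, ?_, ?_, q, ?_, hq⟩ <;> obtain ⟨ζ, -, hm, rfl, h0, rfl⟩ := h
  · rintro _ ⟨t, ht, rfl⟩
    refine hP.mem_D_of_le hq.1 (fun i => ?_) fun i => hm i ht ⟨zero_le_one, le_rfl⟩ ht.2
    have := hm i ⟨le_rfl, zero_le_one⟩ ht ht.1
    simpa [h0] using this
  · exact ⟨0, ⟨le_rfl, zero_le_one⟩, h0⟩
  · exact ⟨1, ⟨zero_le_one, le_rfl⟩, rfl⟩

theorem Core.joins_S : JoinsMonotonically 0 P.x0 P.S := by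
  have := joinsMonotonically_polygon (f := P.start) hP.start_mono P.dbar
  rwa [start_zero] at this

theorem Core.E_subset_D : P.E ⊆ P.D :=
  closure_minimal ((connectedComponentIn_subset _ _).trans fun _ h => h.1) hP.isClosed_D

/-- Along a solution in `𝓓`, interior points of `𝓓` are interior points of `𝓔`. -/
theorem Core.mem_interior_E (hx : P.IsSolutionOn y₀ T x) {b : ℝ} (hb : y₀ ≤ b)
    (hbT : (b : EReal) < T) (hD : ∀ y ∈ Set.Icc y₀ b, x y ∈ P.D) (hint : x b ∈ interior P.D) :
    x b ∈ interior P.E := by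
  have hs : ∀ y ∈ Set.Icc y₀ b, y₀ ≤ y ∧ (y : EReal) < T := fun y hy =>
    ⟨hy.1, (EReal.coe_le_coe_iff.2 hy.2).trans_lt hbT⟩
  have hU : interior P.D ∩ {z | ∀ i, 0 < P.rho z i} ∈ 𝓝 (x b) := by
    refine IsOpen.mem_nhds (isOpen_interior.inter ?_) ⟨hint, hP.rho_pos hx hb hbT⟩
    rw [Set.ofPred_forall]
    exact isOpen_iInter_of_finite fun i => isOpen_lt continuous_const (P.continuous_rho_apply i)
  -- The trace up to time `b` together with a small ball around `x b` is connected and lies in `𝓔'`,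
  -- hence in the component of `x_0`.
  obtain ⟨ε, hε, hball⟩ := Metric.mem_nhds_iff.1 hU
  have hpre : IsPreconnected (x '' Set.Icc y₀ b ∪ Metric.ball (x b) ε) :=
    (isPreconnected_Icc.image x (hx.continuousOn hs)).union (x b)
      ⟨b, ⟨hb, le_rfl⟩, rfl⟩ (Metric.mem_ball_self hε) (convex_ball _ _).isPreconnected
  have hsub : x '' Set.Icc y₀ b ∪ Metric.ball (x b) ε ⊆ connectedComponentIn P.Eprime P.x0 := by
    refine hpre.subset_connectedComponentIn (Or.inl ⟨y₀, ⟨le_rfl, hb⟩, hx.1⟩) ?_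
    rintro z (⟨y, hy, rfl⟩ | hz)
    · exact ⟨hD y hy, fun i => (hP.rho_pos hx (hs y hy).1 (hs y hy).2 i).le⟩
    · exact ⟨interior_subset (hball hz).1, fun i => ((hball hz).2 i).le⟩
  refine mem_interior.2 ⟨Metric.ball (x b) ε, ?_, Metric.isOpen_ball, Metric.mem_ball_self hε⟩
  exact (Set.subset_union_right.trans hsub).trans subset_closure

/-- A maximal solution that stays in `𝓓` converges to a zero of `ρ`. -/
theorem Core.exists_tendsto_zero (hx : P.IsMaximalSolution y₀ yplus x)
    (hD : ∀ y : ℝ, y₀ ≤ y → (y : EReal) < yplus → x y ∈ P.D) :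
    ∃ p ∈ P.zeros, Tendsto x atTop (𝓝 p) := by
  obtain rfl := hP.yplus_eq_top hx hD
  have hsol := hx.2.1
  have hlim : ∀ i, ∃ l, Tendsto (fun y => x y i) atTop (𝓝 l) := fun i => by
    have hm : Monotone fun y => x (max y y₀) i := fun y z hyz =>
      hP.solution_mono hsol (le_max_right _ _) (max_le_max_right _ hyz) (EReal.coe_lt_top _) i
    have hb : BddAbove (Set.range fun y => x (max y y₀) i) := by
      refine ⟨P.top, ?_⟩
      rintro _ ⟨y, rfl⟩
      exact ((hD _ (le_max_right _ _) (EReal.coe_lt_top _)).1 i).2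
    refine ⟨_, (tendsto_atTop_ciSup hm hb).congr' ?_⟩
    filter_upwards [eventually_ge_atTop y₀] with y hy
    rw [max_eq_left hy]
  choose l hl using hlim
  have hp : Tendsto x atTop (𝓝 (WithLp.toLp 2 l)) :=
    ((PiLp.continuous_toLp 2 (fun _ : Fin k => ℝ)).tendsto l).comp (tendsto_pi_nhds.2 hl)
  have hρ : ∀ i, Tendsto (fun y => P.rho (x y) i) atTop (𝓝 (P.rho (WithLp.toLp 2 l) i)) :=
    fun i => ((P.continuous_rho_apply i).tendsto _).comp hp
  refine ⟨WithLp.toLp 2 l, ⟨?_, fun i => le_antisymm ?_ ?_⟩, hp⟩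
  · refine hP.isClosed_D.mem_of_tendsto hp ?_
    filter_upwards [eventually_ge_atTop y₀] with y hy
    exact hD y hy (EReal.coe_lt_top _)
  -- A positive limit of `x_i' = ρ_i` would make `x_i` unbounded.
  · exact limit_deriv_nonpos (fun y hy => (hsol.hasDerivWithinAt_apply (le_of_lt hy)
      (EReal.coe_lt_top _) i).hasDerivAt (Ici_mem_nhds hy)) (hl i) (hρ i)
  · refine ge_of_tendsto (hρ i) ?_
    filter_upwards [eventually_ge_atTop y₀] with y hy
    exact (hP.rho_pos hsol hy (EReal.coe_lt_top _) i).le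

theorem Core.solution_mem_interior (hx : P.IsSolutionOn y₀ T x) {z : Vec k} (hz : z ∈ P.zeros)
    {y : ℝ} (hy : y₀ ≤ y) (hyT : (y : EReal) < T) : x y ∈ interior P.D := by
  have hz0 := hP.mem_D.1 hz.1
  refine hP.mem_interior_D (hP.solution_pos hx hy hyT) fun i => ?_
  exact (hP.lin_lt_of_forall_lt
    (hP.solution_lt hx hz0.1 (fun i => (hz.2 i).le) hy hyT) i).trans_le (hz0.2 i)

theorem Core.exitTime_eq_top (hx : P.IsSolutionOn y₀ T x) (hz : P.zeros.Nonempty) :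
    P.exitTime y₀ T x = ⊤ := by
  obtain ⟨z, hz⟩ := hz
  rw [exitTime, sInf_eq_top]
  rintro _ ⟨y, ⟨hy, hyT, hyE⟩, rfl⟩
  refine absurd (hP.mem_interior_E hx hy.le hyT (fun t ht => ?_)
    (hP.solution_mem_interior hx hz hy.le hyT)) hyE
  exact interior_subset (hP.solution_mem_interior hx hz ht.1
    ((EReal.coe_le_coe_iff.2 ht.2).trans_lt hyT))

theorem Core.yplus_eq_top_of_zeros (hx : P.IsMaximalSolution y₀ yplus x)
    (hz : P.zeros.Nonempty) : yplus = ⊤ := by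
  obtain ⟨z, hz⟩ := hz
  exact hP.yplus_eq_top hx fun y hy hyT =>
    interior_subset (hP.solution_mem_interior hx.2.1 hz hy hyT)

theorem Core.limit_le (hx : P.IsMaximalSolution y₀ ⊤ x) {p w : Vec k}
    (hp : Tendsto x atTop (𝓝 p)) (hw0 : ∀ i, 0 ≤ w i) (hw : ∀ i, P.rho w i ≤ 0) (i : Fin k) :
    p i ≤ w i := by
  have h1 : Tendsto (fun y => x y i) atTop (𝓝 (p i)) :=
    ((EuclideanSpace.proj (𝕜 := ℝ) i).continuous.tendsto p).comp hp
  refine le_of_tendsto h1 ?_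
  filter_upwards [eventually_ge_atTop y₀] with y hy
  exact (hP.solution_lt hx.2.1 hw0 hw hy (EReal.coe_lt_top _) i).le

/-- The ray from a point of `𝓓` in a positive direction leaves `𝓓` through `𝓓̃`. -/
theorem Core.joins_Stilde {p phi : Vec k} (hp : p ∈ P.D) (hphi : ∀ i, 0 < phi i) :
    ∃ q ∈ P.Dtilde, JoinsMonotonically p q (P.Stilde p phi) := by
  have hcont : Continuous fun θ : ℝ => p + θ • phi := by fun_prop
  have hmono : ∀ i, Monotone fun θ : ℝ => (p + θ • phi) i := fun i θ θ' h => by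
    have := mul_le_mul_of_nonneg_right h (hphi i).le
    simp only [PiLp.add_apply, PiLp.smul_apply, smul_eq_mul]
    linarith
  have hp0 := (hP.mem_D.1 hp).1
  let A : Set ℝ := Set.Ici 0 ∩ (fun θ : ℝ => p + θ • phi) ⁻¹' P.D
  have hAclosed : IsClosed A := isClosed_Ici.inter (hP.isClosed_D.preimage hcont)
  have hAbdd : A ⊆ Set.Icc 0 (P.top / phi 0) := fun θ hθ => by
    refine ⟨hθ.1, (le_div_iff₀ (hphi 0)).2 ?_⟩
    have := (hθ.2.1 0).2
    simp only [PiLp.add_apply, PiLp.smul_apply, smul_eq_mul] at this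
    linarith [hp0 0]
  have hA0 : (0 : ℝ) ∈ A := ⟨Set.mem_Ici.2 le_rfl, by simpa using hp⟩
  -- The last parameter at which the ray is in `𝓓`; if all row sums were below `r / (r - 1)` there,
  -- the ray could be prolonged.
  obtain ⟨θ, hθA, hθ⟩ := (isCompact_Icc.of_isClosed_subset hAclosed hAbdd).exists_isGreatest ⟨0, hA0⟩
  have hθ0 : 0 ≤ θ := hθA.1
  have hθD : p + θ • phi ∈ P.D := hθA.2
  refine ⟨p + θ • phi, ⟨hθD, ?_⟩, ?_⟩
  · by_contra! hcon
    have hlin : ∀ i, P.lin (p + θ • phi) i < P.top := fun i =>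
      lt_of_le_of_ne ((hP.mem_D.1 hθD).2 i) (hP.rowSum_eq _ i ▸ hcon i)
    have h1 : ∀ᶠ t in 𝓝[>] θ, ∀ i, P.lin (p + t • phi) i < P.top := by
      refine eventually_all.2 fun i => ?_
      have := ((P.continuous_lin i).comp hcont).tendsto θ
      exact (this.eventually (gt_mem_nhds (hlin i))).filter_mono nhdsWithin_le_nhds
    obtain ⟨t, ht, htθ⟩ := (h1.and self_mem_nhdsWithin).exists
    have ht0 : 0 ≤ t := hθ0.trans (le_of_lt htθ)
    have htA : t ∈ A := by
      refine ⟨ht0, hP.mem_D.2 ⟨fun i => ?_, fun i => (ht i).le⟩⟩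
      have := mul_nonneg ht0 (hphi i).le
      simp only [PiLp.add_apply, PiLp.smul_apply, smul_eq_mul]
      linarith [hp0 i]
    exact absurd htθ (not_lt.2 (hθ htA))
  · have key := joinsMonotonically_image_Icc hθ0 hcont.continuousOn
      (fun i => (hmono i).monotoneOn _)
    have himg : (fun t : ℝ => p + t • phi) '' Set.Icc 0 θ = P.Stilde p phi := by
      ext z
      constructor
      · rintro ⟨t, ht, rfl⟩
        refine ⟨hP.mem_D_of_le hθD (fun i => (hp0 i).trans ?_) fun i => hmono i ht.2, t, ht.1, rfl⟩
        have := hmono i ht.1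
        simpa using this
      · rintro ⟨hz, t, ht, rfl⟩
        exact ⟨t, ⟨ht, hθ ⟨ht, hz⟩⟩, rfl⟩
    rw [himg] at key
    simpa using key

theorem Core.joins_curveE_top (hx : P.IsMaximalSolution y₀ ⊤ x) {p : Vec k}
    (hp : Tendsto x atTop (𝓝 p)) : JoinsMonotonically P.x0 p (curveE y₀ ⊤ x p) := by
  have hsol := hx.2.1
  have h := joinsMonotonically_atTop (y₀ := y₀) (x := x)
    (hsol.continuousOn fun y hy => ⟨hy, EReal.coe_lt_top _⟩)
    (fun i y hy z _ hyz => hP.solution_mono hsol hy hyz (EReal.coe_lt_top _) i) hp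
  rw [hsol.1] at h
  have : {y : ℝ | y₀ ≤ y ∧ (y : EReal) < ⊤} = Set.Ici y₀ := by
    ext y
    simp
  rwa [curveE, this]

/-- If there is no point of `𝓓` with `ρ < 0`, then `ρ ≥ 0` on the curve and on the ray. -/
theorem Core.values_nonneg (hx : P.IsMaximalSolution y₀ ⊤ x) (hS : ¬ P.Sub) {p phi : Vec k}
    {lam : ℝ} (hp : p ∈ P.zeros) (hint : p ∈ interior P.D)
    (hphi : IsPerronFrobenius (P.jacobian p) lam phi) {t : ℝ}
    (ht : t ∈ P.valuesOn (curveE y₀ ⊤ x p ∪ P.Stilde p phi)) : 0 ≤ t := by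
  obtain ⟨z, ((⟨y, ⟨hy, -⟩, rfl⟩ | rfl) | ⟨hz, θ, hθ, rfl⟩), i, rfl⟩ := ht
  · exact (hP.rho_pos hx.2.1 hy (EReal.coe_lt_top _) i).le
  · exact (hp.2 i).ge
  · obtain rfl := hP.eigenvalue_eq_zero hS hp hint hphi
    have := hP.drho_le (hP.mem_D.1 hp.1).1 (hP.mem_D.1 hz).1 i
    rw [isPerronFrobenius_iff] at hphi
    rw [add_sub_cancel_left, drho_smul, hphi.2, hp.2 i] at this
    linarith

theorem Core.isGoodCurve_of_interior_exit (hx : P.IsMaximalSolution y₀ ⊤ x) {p phi : Vec k}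
    (hp : p ∈ P.zeros) (hlim : Tendsto x atTop (𝓝 p)) (hphi : ∀ i, 0 < phi i) :
    P.IsGoodCurve (P.S ∪ curveE y₀ ⊤ x p ∪ P.Stilde p phi) ∧
      ∃ m, IsLeast (P.valuesOn (curveE y₀ ⊤ x p ∪ P.Stilde p phi)) m := by
  obtain ⟨q, hq, hjoin⟩ := hP.joins_Stilde hp.1 hphi
  have hcurve := hP.joins_curveE_top hx hlim
  exact ⟨hP.isGoodCurve ((hP.joins_S.trans hcurve).trans hjoin) hq,
    (hcurve.trans hjoin).exists_isLeast_valuesOn⟩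

/-- If `ρ < 0` somewhere on `𝓓`, then `ρ` has negative values on the ray. -/
theorem Core.exists_neg_mem_values (hx : P.IsMaximalSolution y₀ ⊤ x) (hS : P.Sub)
    {p phi : Vec k} {lam : ℝ} (hp : p ∈ P.zeros) (hint : p ∈ interior P.D)
    (hlim : Tendsto x atTop (𝓝 p)) (hphi : IsPerronFrobenius (P.jacobian p) lam phi) :
    ∃ t ∈ P.valuesOn (curveE y₀ ⊤ x p ∪ P.Stilde p phi), t < 0 := by
  obtain ⟨w, hw, hρ⟩ := hS
  have hlam := hP.eigenvalue_neg hp hρ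
    (hP.limit_le hx hlim (hP.mem_D.1 hw).1 fun i => (hρ i).le) hphi
  obtain ⟨t, ht, htD, hneg⟩ := hP.exists_rho_neg_of_neg_eigenvalue hp hint hphi hlam
  exact ⟨_, ⟨_, Or.inr ⟨htD, t, ht.le, rfl⟩, 0, rfl⟩, hneg 0⟩

/-- The limit lies below any `w` with `ρ(w) < 0`, and strictly so: `p = ρ(p) + p ≤ ρ(w) + w < w`.
Hence all row sums of `p` are below those of `w`. -/
theorem Core.limit_mem_interior_of_sub (hx : P.IsMaximalSolution y₀ ⊤ x) (hS : P.Sub) {p : Vec k}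
    (hp : p ∈ P.zeros) (hlim : Tendsto x atTop (𝓝 p)) : p ∈ interior P.D := by
  obtain ⟨w, hw, hρ⟩ := hS
  have hp0 := (hP.mem_D.1 hp.1).1
  have hle := hP.limit_le hx hlim (hP.mem_D.1 hw).1 fun i => (hρ i).le
  have hlt : ∀ i, p i < w i := fun i => by
    linarith [hP.rho_le_of_le hp0 hle i, hp.2 i, hρ i]
  exact hP.mem_interior_D (hP.pos_of_rho_nonpos hp0 fun i => (hp.2 i).le) fun i =>
    (hP.lin_lt_of_forall_lt hlt i).trans_le ((hP.mem_D.1 hw).2 i)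

theorem Core.sub_iff_subPrime (hx : P.IsMaximalSolution y₀ yplus x) :
    P.Sub ↔ P.SubPrime y₀ yplus x := by
  constructor
  · intro hS
    have hz := hP.zeros_nonempty_of_sub hS
    obtain rfl := hP.yplus_eq_top_of_zeros hx hz
    have hexit := hP.exitTime_eq_top hx.2.1 hz
    obtain ⟨z, hz⟩ := hz
    obtain ⟨p, hp, hlim⟩ := hP.exists_tendsto_zero hx fun y hy hyT =>
      interior_subset (hP.solution_mem_interior hx.2.1 hz hy hyT)
    have hint := hP.limit_mem_interior_of_sub hx hS hp hlim
    obtain ⟨lam, phi, hphi⟩ := hP.exists_isPerronFrobenius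
      (hP.pos_of_rho_nonpos (hP.mem_D.1 hp.1).1 fun i => (hp.2 i).le)
    obtain ⟨hgood, m, hm⟩ := hP.isGoodCurve_of_interior_exit hx hp hlim hphi.1
    obtain ⟨t, ht, ht0⟩ := hP.exists_neg_mem_values hx hS hp hint hlim hphi
    refine ⟨m, (hm.2 ht).trans_lt ht0, hexit, p, ?_, ⟨hp, hint⟩, lam, phi, hphi, ?_⟩
    · rwa [hexit, isExitPoint_top_iff]
    · rw [hexit]
      exact ⟨hgood, hm⟩
  · rintro ⟨m, hm, hexit, p, -, ⟨hp, hint⟩, lam, phi, hphi, -, hleast⟩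
    obtain rfl := hP.yplus_eq_top_of_zeros hx ⟨p, hp⟩
    rw [hexit] at hleast
    by_contra hS
    exact absurd (hP.values_nonneg hx hS hp hint hphi hleast.1) (not_le.2 hm)

theorem Core.crit_iff_critPrime (hk : 2 ≤ k) (hx : P.IsMaximalSolution y₀ yplus x) :
    P.Crit ↔ P.CritPrime y₀ yplus x := by
  constructor
  · intro hC
    obtain ⟨hz, hS⟩ := hP.minCrit_iff.1 (hP.minCrit_of_crit hC)
    obtain rfl := hP.yplus_eq_top_of_zeros hx hz
    have hexit := hP.exitTime_eq_top hx.2.1 hz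
    obtain ⟨z, hz⟩ := hz
    obtain ⟨p, hp, hlim⟩ := hP.exists_tendsto_zero hx fun y hy hyT =>
      interior_subset (hP.solution_mem_interior hx.2.1 hz hy hyT)
    have hint := hP.zero_mem_interior hk hS hp
    obtain ⟨lam, phi, hphi⟩ := hP.exists_isPerronFrobenius
      (hP.pos_of_rho_nonpos (hP.mem_D.1 hp.1).1 fun i => (hp.2 i).le)
    refine ⟨hexit, p, ?_, ⟨hp, hint⟩, lam, phi, hphi, ?_⟩
    · rwa [hexit, isExitPoint_top_iff]
    · rw [hexit]
      exact ⟨(hP.isGoodCurve_of_interior_exit hx hp hlim hphi.1).1,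
        ⟨p, Or.inl (Or.inr rfl), 0, hp.2 0⟩,
        fun t ht => hP.values_nonneg hx hS hp hint hphi ht⟩
  · rintro ⟨hexit, p, hlim, ⟨hp, hint⟩, lam, phi, hphi, -, hleast⟩
    obtain rfl := hP.yplus_eq_top_of_zeros hx ⟨p, hp⟩
    rw [hexit] at hleast
    rw [hexit, isExitPoint_top_iff] at hlim
    refine hP.crit_of_minCrit hk (hP.minCrit_iff.2 ⟨⟨p, hp⟩, fun hS => ?_⟩)
    obtain ⟨t, ht, ht0⟩ := hP.exists_neg_mem_values hx hS hp hint hlim hphi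
    exact absurd (hleast.2 ht) (not_le.2 ht0)

theorem Core.sup_of_supPrime (hx : P.IsMaximalSolution y₀ yplus x)
    (h : P.SupPrime y₀ yplus x) : P.Sup := by
  rw [sup_iff]
  by_contra hne
  have := hP.exitTime_eq_top hx.2.1 (Set.nonempty_iff_ne_empty.2 hne)
  exact h.1.ne this

/-- A solution that stayed in the interior of `𝓓` would converge to a zero. At the first time
outside it the coordinates are positive, so a row sum must have reached `r / (r - 1)`; until then
the interior of `𝓔` is not left either. -/
theorem Core.supPrime_of_sup (hx : P.IsMaximalSolution y₀ yplus x) (h0 : P.x0 ∈ interior P.D)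
    (hS : P.Sup) : P.SupPrime y₀ yplus x := by
  have hsol := hx.2.1
  obtain ⟨y₁, hy₁, hy₁T, hy₁D⟩ :
      ∃ y : ℝ, y₀ ≤ y ∧ (y : EReal) < yplus ∧ x y ∉ interior P.D := by
    by_contra! hcon
    obtain ⟨p, hp, -⟩ := hP.exists_tendsto_zero hx fun y hy hyT => interior_subset (hcon y hy hyT)
    rw [sup_iff.1 hS] at hp
    exact hp
  have hT : ∀ y : ℝ, y ≤ y₁ → (y : EReal) < yplus := fun y hy =>
    (EReal.coe_le_coe_iff.2 hy).trans_lt hy₁T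
  have hc : ContinuousOn x (Set.Icc y₀ y₁) := hsol.continuousOn fun y hy => ⟨hy.1, hT y hy.2⟩
  have hB : IsCompact (Set.Icc y₀ y₁ ∩ x ⁻¹' (interior P.D)ᶜ) :=
    isCompact_Icc.of_isClosed_subset
      (hc.preimage_isClosed_of_isClosed isClosed_Icc isOpen_interior.isClosed_compl)
      Set.inter_subset_left
  obtain ⟨b, ⟨hb, hbD⟩, hmin⟩ := hB.exists_isLeast ⟨y₁, ⟨hy₁, le_rfl⟩, hy₁D⟩
  have hlt : ∀ y ∈ Set.Ico y₀ b, x y ∈ interior P.D := fun y hy => by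
    by_contra hcon
    exact absurd (hmin ⟨⟨hy.1, hy.2.le.trans hb.2⟩, hcon⟩) (not_le.2 hy.2)
  -- The exit time only looks at times after `y₀`, so the start in the interior is needed for `b` to
  -- count.
  have hb0 : y₀ < b := by
    refine lt_of_le_of_ne hb.1 fun h => hbD ?_
    rw [← h, hsol.1]
    exact h0
  have hbT := hT b hb.2
  have hcb : ContinuousOn x (Set.Icc y₀ b) := hc.mono (Set.Icc_subset_Icc_right hb.2)
  have hxb : x b ∈ P.D := by
    have h1 : Set.MapsTo x (Set.Ico y₀ b) P.D := fun y hy => interior_subset (hlt y hy)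
    have h2 : x b ∈ closure (x '' Set.Ico y₀ b) := by
      refine ((hcb b ⟨hb.1, le_rfl⟩).mono Set.Ico_subset_Icc_self).mem_closure_image ?_
      rw [closure_Ico hb0.ne]
      exact ⟨hb.1, le_rfl⟩
    exact closure_minimal h1.image_subset hP.isClosed_D h2
  have hexit : P.exitTime y₀ yplus x = b := by
    refine IsLeast.csInf_eq ⟨⟨b, ⟨hb0, hbT, fun h => hbD (interior_mono hP.E_subset_D h)⟩, rfl⟩, ?_⟩
    rintro _ ⟨y, ⟨hy, hyT, hyE⟩, rfl⟩
    by_contra hcon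
    have hyb : y < b := EReal.coe_lt_coe_iff.1 (not_le.1 hcon)
    exact hyE (hP.mem_interior_E hsol hy.le hyT
      (fun t ht => interior_subset (hlt t ⟨ht.1, ht.2.trans_lt hyb⟩)) (hlt y ⟨hy.le, hyb⟩))
  have hDt : x b ∈ P.Dtilde := by
    refine ⟨hxb, ?_⟩
    by_contra! hcon
    exact hbD (hP.mem_interior_D (hP.solution_pos hsol hb.1 hbT) fun i =>
      lt_of_le_of_ne ((hP.mem_D.1 hxb).2 i) (hP.rowSum_eq _ i ▸ hcon i))
  have hcurve : curveE y₀ b x (x b) = x '' Set.Icc y₀ b := by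
    have h1 : {y : ℝ | y₀ ≤ y ∧ (y : EReal) < b} = Set.Ico y₀ b := by
      ext y
      simp
    rw [curveE, h1, ← Set.image_singleton, ← Set.image_union, Set.Ico_union_right hb.1]
  have hjoin := joinsMonotonically_image_Icc hb.1 hcb fun i y hy z hz hyz =>
    hP.solution_mono hsol hy.1 hyz (hT z (hz.2.trans hb.2)) i
  rw [hsol.1] at hjoin
  refine ⟨hexit ▸ EReal.coe_lt_top b, x b, ?_, hDt, hP.rho_pos hsol hb.1 hbT, ?_⟩
  · rw [hexit]
    exact isExitPoint_coe_of_continuousWithinAt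
      ((hcb b ⟨hb.1, le_rfl⟩).mono Set.Ioo_subset_Icc_self)
  · rw [hexit, hcurve]
    refine ⟨hP.isGoodCurve (hP.joins_S.trans hjoin) hDt, ?_⟩
    obtain ⟨m, hm⟩ := hjoin.exists_isLeast_valuesOn (P := P)
    refine ⟨m, ?_, hm⟩
    obtain ⟨_, ⟨y, hy, rfl⟩, i, rfl⟩ := hm.1
    exact hP.rho_pos hsol hy.1 (hT y (hy.2.trans hb.2)) i

end Main

end LimitData

end Bootstrap

theorem mainTheorem3 {k : ℕ} [NeZero k] (r : ℕ) (M : Bootstrap.SBMSequence k)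
    (nu gam mu : Fin k → Fin k → ℝ) (alpha : Fin k → ℝ)
    (hM : Bootstrap.ModelAssumptions r M nu gam mu alpha)
    (P : Bootstrap.LimitData k) (hP : P = ⟨r, Bootstrap.chiMatrix r nu gam mu, alpha⟩)
    (y₀ : ℝ) :
    (∃ (yplus : EReal) (x : ℝ → Bootstrap.Vec k), P.IsMaximalSolution y₀ yplus x) ∧
    ∀ (yplus : EReal) (x : ℝ → Bootstrap.Vec k), P.IsMaximalSolution y₀ yplus x →
      ((P.MinSub ↔ P.Sub) ∧ (P.Sub ↔ P.SubPrime y₀ yplus x)) ∧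
      ((P.MinSup ↔ P.Sup) ∧ (P.SupPrime y₀ yplus x → P.Sup) ∧
        (P.x0 ∈ interior P.D → P.Sup → P.SupPrime y₀ yplus x)) ∧
      (2 ≤ k → (P.MinCrit ↔ P.Crit) ∧ (P.Crit ↔ P.CritPrime y₀ yplus x)) := by
  have hC : P.Core := hP ▸ hM.core
  refine ⟨hC.exists_isMaximalSolution y₀, fun yplus x hx => ⟨⟨hC.minSub_iff, ?_⟩,
    ⟨hC.minSup_iff, ?_, ?_⟩, fun hk => ⟨⟨hC.crit_of_minCrit hk, hC.minCrit_of_crit⟩, ?_⟩⟩⟩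
  · exact hC.sub_iff_subPrime hx
  · exact hC.sup_of_supPrime hx
  · exact hC.supPrime_of_sup hx
  · exact hC.crit_iff_critPrime hk hx
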